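/- \textbf{Setting.} Terms and bags of the resource calculus are given by $M::=x\mid\lambda x.M\mid MP$ and $P::=1\mid [M]\cdot P\mid[M^!]\cdot P$, up to $\alpha$-equivalence; bags are finite multisets of linear ($M$) and reusable ($M^!$) resources. Sums are finite multisets of expressions, and all constructors but $(\cdot)^!$ commute with sums, while $[(\sum_{i\le k}M_i)^!]\cdot P:=[M_1^!,\dots,M_k^!]\cdot P$ (so $[0^!]\cdot P=P$). $A\{\mathbb S/x\}$ is capture-free substitution of a sum $\mathbb S$. Linear substitution $A\langle N/x\rangle$ is defined by $x\langle N/x\rangle=N$; $y\langle N/x\rangle=0$ for $y\ne x$; $(\lambda y.M)\langle N/x\rangle=\lambda y.M\langle N/x\rangle$ for $y\ne x$ not free in $N$; $(MP)\langle N/x\rangle=M\langle N/x\rangle P+M\,P\langle N/x\rangle$; $1\langle N/x\rangle=0$; $([M]\cdot P)\langle N/x\rangle=[M\langle N/x\rangle]\cdot P+[M]\cdot P\langle N/x\rangle$; $([M^!]\cdot P)\langle N/x\rangle=[M\langle N/x\rangle,M^!]\cdot P+[M^!]\cdot P\langle N/x\rangle$. Put $A\langle N^!/x\rangle:=A\{N+x/x\}$,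 and let $A\langle P/x\rangle$ be obtained by substituting the resources of the bag $P$ one after the other ($x$ not free in $P$). \textbf{Reductions.} The giant step $\to_g$ is the closure of $(\lambda x.M)P\to_g M\langle P/x\rangle\{0/x\}$ under all contexts with exactly one hole (contexts being extended to sums as above), and $M\to_{nd}N$ iff $M\to_g N+\mathbb A$ for some sum $\mathbb A$. The set $\mathcal L(A)$ of leftmost redexes (redex occurrences) is given by $\mathcal L(x)=\mathcal L(1)=\emptyset$, $\mathcal L(\lambda x.M)=\mathcal L(M)$, $\mathcal L([M^!]\cdot P)=\mathcal L(P)$, $\mathcal L([M]\cdot P)=\mathcal L(M)\cup\mathcal L(P)$, and $\mathcal L(MP)=\{MP\}$ if $M$ is an abstraction, otherwise $\mathcal L(M)$ if this is non-empty, otherwise $\mathcal L(P)$. Write $M\to_{lm}N$ if $M\to_{nd}N$ by firing a redex of $\mathcal L(M)$, and $M\to_{\neg lm}N$ if $M\to_{nd}N$ by firing a redex (possibly inside a reusable resource) that is not in $\mathcal L(M)$. A star denotes reflexive-transitive closure. An expression is an outer normal form (onf) if all its redexes lie under the scope of a $(\cdot)^!$. $N$ is a may-outer-normal form (monf) of $M$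 if $M\to_{nd}^*N$ and $N$ is an onf; $M$ is may-outer-normalizable if it has a monf. \textbf{The machine.} $M\Downarrow N$ and the auxiliary $P\Downarrow_bP'$ are the least relations closed under the following rules ($m\ge0$): \begin{itemize} \item if $M\Downarrow M'$ then $\lambda x.M\Downarrow\lambda x.M'$; if $M$ is an onf then $M\Downarrow M$; \item if $P_i\Downarrow_bP_i'$ for $1\le i\le m$ then $xP_1\dots P_m\Downarrow xP_1'\dots P_m'$; \item if $M\{0/x\}$ is a term (not $0$) and $M\{0/x\}P_1\dots P_m\Downarrow M'$ then $(\lambda x.M)1P_1\dots P_m\Downarrow M'$; \item if $M\langle N/x\rangle=M'+\mathbb A$ ($x$ not free in $N$) and $(\lambda x.M')PP_1\dots P_m\Downarrow M''$ then $(\lambda x.M)([N]\cdot P)P_1\dots P_m\Downarrow M''$; \item if $M\{N+x/x\}=M'+\mathbb A$ ($x$ not free in $N$) and $(\lambda x.M')PP_1\dots P_m\Downarrow M''$ then $(\lambda x.M)([N^!]\cdot P)P_1\dots P_m\Downarrow M''$; \item $1\Downarrow_b1$; if $M\Downarrow N$ and $P\Downarrow_bP'$ then $[M]\cdot P\Downarrow_b[N]\cdot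 P'$; if $P\Downarrow_bP'$ then $[M^!]\cdot P\Downarrow_b[M^!]\cdot P'$. \end{itemize} \textbf{Theorem} (Soundness and Completeness of the ND-machine). (i) Soundness: if $M\Downarrow N$, then $M\to_{lm}^*N$ and $N$ is an onf. (ii) Completeness: if $M$ is may-outer-normalizable and $N$ is a monf of $M$, then there is a term $N'$ such that $M\Downarrow N'$, $N'$ is a monf of $M$, and $N'\to_{\neg lm}^*N$. -/

import Mathlib

namespace ResourceCalculus

/-! ### Syntax -/

/-- The two sorts of expressions: terms and bags. -/
inductive Kind
  | term
  | bag

/-- A resource is linear, `M`, or reusable, `M^!`. -/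
inductive Mode
  | linear
  | reusable

/-- Raw expressions, with de Bruijn indices (so that `α`-equivalent expressions are equal):
terms `x | λx.M | M P`, and bags `1 | [M^(!)]·P`, here still listed in some order. -/
inductive PreExpr : Kind → Type
  | var : ℕ → PreExpr .term
  | lam : PreExpr .term → PreExpr .term
  | app : PreExpr .term → PreExpr .bag → PreExpr .term
  | one : PreExpr .bag
  | cons : Mode → PreExpr .term → PreExpr .bag → PreExpr .bag

/-- The congruence on raw expressions generated by exchanging two resources of a bag. -/
inductive PreExpr.Equiv : {s : Kind} → PreExpr s → PreExpr s → Prop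
  | refl {s : Kind} (a : PreExpr s) : PreExpr.Equiv a a
  | symm {s : Kind} {a b : PreExpr s} : PreExpr.Equiv a b → PreExpr.Equiv b a
  | trans {s : Kind} {a b c : PreExpr s} :
      PreExpr.Equiv a b → PreExpr.Equiv b c → PreExpr.Equiv a c
  | lam {m m' : PreExpr .term} : PreExpr.Equiv m m' → PreExpr.Equiv (.lam m) (.lam m')
  | app {m m' : PreExpr .term} {p p' : PreExpr .bag} :
      PreExpr.Equiv m m' → PreExpr.Equiv p p' → PreExpr.Equiv (.app m p) (.app m' p')
  | cons (r : Mode) {m m' : PreExpr .term} {p p' : PreExpr .bag} :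
      PreExpr.Equiv m m' → PreExpr.Equiv p p' → PreExpr.Equiv (.cons r m p) (.cons r m' p')
  | swap (r r' : Mode) (m m' : PreExpr .term) (p : PreExpr .bag) :
      PreExpr.Equiv (.cons r m (.cons r' m' p)) (.cons r' m' (.cons r m p))

instance PreExpr.setoid (s : Kind) : Setoid (PreExpr s) where
  r := PreExpr.Equiv
  iseqv := ⟨PreExpr.Equiv.refl, PreExpr.Equiv.symm, PreExpr.Equiv.trans⟩

/-- Expressions of the resource calculus: at every depth bags are finite multisets. -/
def Expr (s : Kind) : Type := Quotient (PreExpr.setoid s)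

/-- Simple terms. -/
abbrev Term : Type := Expr .term

/-- Bags: finite multisets of resources. -/
abbrev Bag : Type := Expr .bag

/-- Finite formal sums of expressions; the sum `0` is the empty multiset. -/
abbrev FormalSum (s : Kind) : Type := Multiset (Expr s)

/-- The class of a raw expression. -/
def PreExpr.toExpr {s : Kind} (a : PreExpr s) : Expr s := Quotient.mk (PreExpr.setoid s) a

theorem PreExpr.Equiv.toExpr_eq {s : Kind} {a b : PreExpr s} (h : PreExpr.Equiv a b) :
    a.toExpr = b.toExpr :=
  Quotient.sound h

/-- The variable with de Bruijn index `n`. -/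
def Expr.var (n : ℕ) : Term := (PreExpr.var n).toExpr

/-- Abstraction `λx.M`, binding the index `0` of `M`. -/
def Expr.lam : Term → Term :=
  Quotient.lift (fun m => (PreExpr.lam m).toExpr) fun _ _ h => (PreExpr.Equiv.lam h).toExpr_eq

/-- Application `M P` of a term to a bag. -/
def Expr.app : Term → Bag → Term :=
  Quotient.lift₂ (fun m p => (PreExpr.app m p).toExpr)
    fun _ _ _ _ h k => (PreExpr.Equiv.app h k).toExpr_eq

/-- The empty bag `1`. -/
def Expr.one : Bag := PreExpr.one.toExpr

/-- The bag `[M]·P` (mode `linear`) or `[M^!]·P` (mode `reusable`). -/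
def Expr.cons (r : Mode) : Term → Bag → Bag :=
  Quotient.lift₂ (fun m p => (PreExpr.cons r m p).toExpr)
    fun _ _ _ _ h k => (PreExpr.Equiv.cons r h k).toExpr_eq

theorem Expr.cons_swap (r r' : Mode) (M M' : Term) (P : Bag) :
    Expr.cons r M (Expr.cons r' M' P) = Expr.cons r' M' (Expr.cons r M P) := by
  induction M using Quotient.inductionOn
  induction M' using Quotient.inductionOn
  induction P using Quotient.inductionOn
  exact (PreExpr.Equiv.swap r r' _ _ _).toExpr_eq

instance : LeftCommutative (Expr.cons .reusable) := ⟨Expr.cons_swap .reusable .reusable⟩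

/-- `[(M₁ + ⋯ + M_k)^!]·P = [M₁^!, …, M_k^!]·P`; in particular `[0^!]·P = P`. -/
def bangSum (S : FormalSum .term) (P : Bag) : Bag := S.foldr (Expr.cons .reusable) P

/-- `M P₁ … P_m`. -/
def apps (M : Term) (Ps : List Bag) : Term := Ps.foldl Expr.app M

/-! ### Renaming -/

/-- A renaming of indices, under one binder. -/
def liftRen (ρ : ℕ → ℕ) : ℕ → ℕ
  | 0 => 0
  | n + 1 => ρ n + 1

/-- Renaming of the free indices. -/
def PreExpr.rename : {s : Kind} → (ℕ → ℕ) → PreExpr s → PreExpr s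
  | _, ρ, .var n => .var (ρ n)
  | _, ρ, .lam m => .lam (m.rename (liftRen ρ))
  | _, ρ, .app m p => .app (m.rename ρ) (p.rename ρ)
  | _, _, .one => .one
  | _, ρ, .cons r m p => .cons r (m.rename ρ) (p.rename ρ)

theorem PreExpr.Equiv.rename {s : Kind} {a b : PreExpr s} (h : PreExpr.Equiv a b) :
    ∀ ρ : ℕ → ℕ, PreExpr.Equiv (a.rename ρ) (b.rename ρ) := by
  induction h with
  | refl a => exact fun ρ => .refl _
  | symm _ ih => exact fun ρ => (ih ρ).symm
  | trans _ _ ih ih' => exact fun ρ => (ih ρ).trans (ih' ρ)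
  | lam _ ih => exact fun ρ => .lam (ih _)
  | app _ _ ih ih' => exact fun ρ => .app (ih ρ) (ih' ρ)
  | cons r _ _ ih ih' => exact fun ρ => .cons r (ih ρ) (ih' ρ)
  | swap r r' m m' p => exact fun ρ => .swap r r' _ _ _

/-- Renaming of the free indices of an expression. -/
def Expr.rename {s : Kind} (ρ : ℕ → ℕ) : Expr s → Expr s :=
  Quotient.lift (fun a => (a.rename ρ).toExpr) fun _ _ h => (PreExpr.Equiv.rename h ρ).toExpr_eq

/-- The expression seen from under one more binder: index `0` does not occur in `A.shift`. -/
def Expr.shift {s : Kind} (A : Expr s) : Expr s := A.rename Nat.succ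

/-! ### Substitutions -/

/-- A simultaneous substitution of sums for indices, under one binder. -/
def liftSub (σ : ℕ → FormalSum .term) : ℕ → FormalSum .term
  | 0 => {Expr.var 0}
  | n + 1 => (σ n).map Expr.shift

/-- Capture-free substitution of sums of terms for the free indices. All constructors but `(·)^!`
commute with sums. -/
def PreExpr.subst : {s : Kind} → (ℕ → FormalSum .term) → PreExpr s → FormalSum s
  | _, σ, .var n => σ n
  | _, σ, .lam m => (m.subst (liftSub σ)).map Expr.lam
  | _, σ, .app m p => (m.subst σ).bind fun M => (p.subst σ).map fun P => Expr.app M P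
  | _, _, .one => {Expr.one}
  | _, σ, .cons .linear m p =>
      (m.subst σ).bind fun M => (p.subst σ).map fun P => Expr.cons .linear M P
  | _, σ, .cons .reusable m p => (p.subst σ).map fun P => bangSum (m.subst σ) P

/-- Linear substitution of the term `N` for the index `x`. -/
def PreExpr.linSubst : {s : Kind} → ℕ → Term → PreExpr s → FormalSum s
  | _, x, N, .var y => if y = x then {N} else 0
  | _, x, N, .lam m => (m.linSubst (x + 1) N.shift).map Expr.lam
  | _, x, N, .app m p =>
      ((m.linSubst x N).map fun M => Expr.app M p.toExpr) +
        (p.linSubst x N).map fun P => Expr.app m.toExpr P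
  | _, _, _, .one => 0
  | _, x, N, .cons .linear m p =>
      ((m.linSubst x N).map fun M => Expr.cons .linear M p.toExpr) +
        (p.linSubst x N).map fun P => Expr.cons .linear m.toExpr P
  | _, x, N, .cons .reusable m p =>
      ((m.linSubst x N).map fun M =>
          Expr.cons .linear M (Expr.cons .reusable m.toExpr p.toExpr)) +
        (p.linSubst x N).map fun P => Expr.cons .reusable m.toExpr P

theorem bangSum_cons (r : Mode) (S : FormalSum .term) (M : Term) (P : Bag) :
    bangSum S (Expr.cons r M P) = Expr.cons r M (bangSum S P) := by
  unfold bangSum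
  induction S using Multiset.induction_on with
  | empty => simp
  | cons a S ih => rw [Multiset.foldr_cons, Multiset.foldr_cons, ih, Expr.cons_swap]

theorem bangSum_comm (S T : FormalSum .term) (P : Bag) :
    bangSum S (bangSum T P) = bangSum T (bangSum S P) := by
  induction T using Multiset.induction_on with
  | empty => simp [bangSum]
  | cons a T ih =>
    have h : ∀ Q, bangSum (a ::ₘ T) Q = Expr.cons .reusable a (bangSum T Q) := fun Q => by
      simp [bangSum]
    rw [h, h, bangSum_cons, ih]

theorem PreExpr.Equiv.subst {s : Kind} {a b : PreExpr s} (h : PreExpr.Equiv a b) :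
    ∀ σ : ℕ → FormalSum .term, a.subst σ = b.subst σ := by
  induction h with
  | refl a => exact fun σ => rfl
  | symm _ ih => exact fun σ => (ih σ).symm
  | trans _ _ ih ih' => exact fun σ => (ih σ).trans (ih' σ)
  | lam _ ih => intro σ; simp only [PreExpr.subst, ih]
  | app _ _ ih ih' => intro σ; simp only [PreExpr.subst, ih, ih']
  | cons r _ _ ih ih' => intro σ; cases r <;> simp only [PreExpr.subst, ih, ih']
  | swap r r' m m' p =>
    intro σ
    cases r <;> cases r' <;>
      simp only [PreExpr.subst, Multiset.map_bind, Multiset.map_map, Function.comp_def,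
        bangSum_cons]
    · rw [Multiset.bind_bind]
      simp only [Expr.cons_swap]
    · exact Multiset.map_congr rfl fun P _ => bangSum_comm _ _ _

theorem PreExpr.Equiv.linSubst {s : Kind} {a b : PreExpr s} (h : PreExpr.Equiv a b) :
    ∀ (x : ℕ) (N : Term), a.linSubst x N = b.linSubst x N := by
  induction h with
  | refl a => exact fun x N => rfl
  | symm _ ih => exact fun x N => (ih x N).symm
  | trans _ _ ih ih' => exact fun x N => (ih x N).trans (ih' x N)
  | lam _ ih => intro x N; simp only [PreExpr.linSubst, ih]
  | app h h' ih ih' =>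
    intro x N; simp only [PreExpr.linSubst, ih, ih', h.toExpr_eq, h'.toExpr_eq]
  | cons r h h' ih ih' =>
    intro x N; cases r <;> simp only [PreExpr.linSubst, ih, ih', h.toExpr_eq, h'.toExpr_eq]
  | swap r r' m m' p =>
    intro x N
    have e : ∀ (r : Mode) (m : PreExpr .term) (p : PreExpr .bag),
        (PreExpr.cons r m p).toExpr = Expr.cons r m.toExpr p.toExpr := fun _ _ _ => rfl
    cases r <;> cases r' <;>
      simp only [PreExpr.linSubst, Multiset.map_add, Multiset.map_map, Function.comp_def, e] <;>
      rw [add_left_comm] <;>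
      refine congrArg₂ _ (Multiset.map_congr rfl fun M _ => ?_)
        (congrArg₂ _ (Multiset.map_congr rfl fun M _ => ?_)
          (Multiset.map_congr rfl fun M _ => ?_)) <;>
      grind [Expr.cons_swap]

/-- Capture-free substitution of sums of terms for the free indices of an expression. -/
def Expr.subst {s : Kind} (σ : ℕ → FormalSum .term) : Expr s → FormalSum s :=
  Quotient.lift (fun a => a.subst σ) fun _ _ h => PreExpr.Equiv.subst h σ

/-- Linear substitution `A⟨N/x⟩`. -/
def Expr.linSubst {s : Kind} (A : Expr s) (x : ℕ) (N : Term) : FormalSum s :=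
  Quotient.lift (fun a => a.linSubst x N) (fun _ _ h => PreExpr.Equiv.linSubst h x N) A

/-- Partial substitution `A{N + x / x}`. -/
def Expr.partialSubst {s : Kind} (A : Expr s) (x : ℕ) (N : Term) : FormalSum s :=
  A.subst fun y => if y = x then {N} + {Expr.var x} else {Expr.var y}

/-- Resource substitution: `A⟨N/x⟩` for a linear resource, `A{N + x / x}` for a reusable one. -/
def Expr.resSubst {s : Kind} (A : Expr s) (x : ℕ) (r : Mode) (N : Term) : FormalSum s :=
  match r with
  | .linear => Expr.linSubst A x N
  | .reusable => Expr.partialSubst A x N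

/-- Bag substitution: `BagSubst x S P T` says `S⟨P/x⟩ = T`, where the resources of `P` are
substituted one after the other (linearly in the sum `S`), in some order. -/
inductive BagSubst {s : Kind} (x : ℕ) : FormalSum s → Bag → FormalSum s → Prop
  | one (S : FormalSum s) : BagSubst x S Expr.one S
  | cons (r : Mode) (N : Term) (P : Bag) (S T : FormalSum s) :
      BagSubst x (S.bind fun A => Expr.resSubst A x r N) P T → BagSubst x S (Expr.cons r N P) T

/-- `M{0/x}` for the bound variable `x` (index `0`) of `λx.M`, as an expression living outside
of that binder. -/
def Expr.zeroSubst {s : Kind} : Expr s → FormalSum s :=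
  Expr.subst fun
    | 0 => 0
    | n + 1 => {Expr.var n}

/-! ### Contexts and redexes -/

/-- Simple contexts (one occurrence of the hole). As bags are unordered, a simple bag context is
`[C^(!)]·P` with `C` a simple term context. -/
inductive Ctx : Kind → Type
  | hole : Ctx .term
  | lam : Ctx .term → Ctx .term
  | appL : Ctx .term → Bag → Ctx .term
  | appR : Term → Ctx .bag → Ctx .term
  | bag : Mode → Ctx .term → Bag → Ctx .bag

/-- `C[M]`, with possible capture of variables. -/
def Ctx.fill : {s : Kind} → Ctx s → Term → Expr s
  | _, .hole, M => M
  | _, .lam C, M => Expr.lam (C.fill M)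
  | _, .appL C P, M => Expr.app (C.fill M) P
  | _, .appR L C, M => Expr.app L (C.fill M)
  | _, .bag r C P, M => Expr.cons r (C.fill M) P

/-- `C[S]` for a sum `S` of terms: all constructors but `(·)^!` commute with sums. -/
def Ctx.fillSum : {s : Kind} → Ctx s → FormalSum .term → FormalSum s
  | _, .hole, S => S
  | _, .lam C, S => (C.fillSum S).map Expr.lam
  | _, .appL C P, S => (C.fillSum S).map fun M => Expr.app M P
  | _, .appR L C, S => (C.fillSum S).map fun P => Expr.app L P
  | _, .bag .linear C P, S => (C.fillSum S).map fun M => Expr.cons .linear M P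
  | _, .bag .reusable C P, S => {bangSum (C.fillSum S) P}

/-- The hole is not under the scope of a `(·)^!`. -/
def Ctx.IsLinear : {s : Kind} → Ctx s → Prop
  | _, .hole => True
  | _, .lam C => C.IsLinear
  | _, .appL C _ => C.IsLinear
  | _, .appR _ C => C.IsLinear
  | _, .bag .linear C _ => C.IsLinear
  | _, .bag .reusable _ _ => False

/-- The context `[M^(!)]·C`, for a bag context `C`. -/
def Ctx.consTail (r : Mode) (M : Term) : Ctx .bag → Ctx .bag
  | .bag r' C P => .bag r' C (Expr.cons r M P)

/-- A redex is a term `(λx.M)P`. -/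
def IsRedex (R : Term) : Prop := ∃ (M : Term) (P : Bag), R = Expr.app (Expr.lam M) P

/-- Occurrences of subterms: the occurrence `(C, R)` is the subterm `R` of `C[R]` that stands at
the hole of `C`. -/
abbrev Occ (s : Kind) : Type := Ctx s × Term

/-- The raw expression is an abstraction. -/
def PreExpr.IsLam : {s : Kind} → PreExpr s → Prop
  | _, .lam _ => True
  | _, _ => False

open Classical in
/-- The leftmost redexes of a raw expression. -/
def PreExpr.leftmost : {s : Kind} → PreExpr s → Set (Occ s)
  | _, .var _ => ∅
  | _, .lam m => (fun o : Occ .term => (Ctx.lam o.1, o.2)) '' m.leftmost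
  | _, .app m p =>
      if m.IsLam then {(Ctx.hole, (PreExpr.app m p).toExpr)}
      else if m.leftmost ≠ ∅ then
        (fun o : Occ .term => (Ctx.appL o.1 p.toExpr, o.2)) '' m.leftmost
      else (fun o : Occ .bag => (Ctx.appR m.toExpr o.1, o.2)) '' p.leftmost
  | _, .one => ∅
  | _, .cons .reusable m p =>
      (fun o : Occ .bag => (o.1.consTail .reusable m.toExpr, o.2)) '' p.leftmost
  | _, .cons .linear m p =>
      (fun o : Occ .term => (Ctx.bag .linear o.1 p.toExpr, o.2)) '' m.leftmost ∪
        (fun o : Occ .bag => (o.1.consTail .linear m.toExpr, o.2)) '' p.leftmost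

theorem PreExpr.Equiv.isLam {s : Kind} {a b : PreExpr s} (h : PreExpr.Equiv a b) :
    a.IsLam ↔ b.IsLam := by
  induction h with
  | symm _ ih => exact ih.symm
  | trans _ _ ih ih' => exact ih.trans ih'
  | _ => simp [PreExpr.IsLam]

theorem Ctx.consTail_bag (r r' : Mode) (M : Term) (C : Ctx .term) (P : Bag) :
    (Ctx.bag r' C P).consTail r M = Ctx.bag r' C (Expr.cons r M P) := rfl

theorem Ctx.consTail_swap (r r' : Mode) (M M' : Term) (C : Ctx .bag) :
    (C.consTail r' M').consTail r M = (C.consTail r M).consTail r' M' := by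
  cases C with
  | bag q C P => simp only [Ctx.consTail, Expr.cons_swap r r']

theorem PreExpr.Equiv.leftmost {s : Kind} {a b : PreExpr s} (h : PreExpr.Equiv a b) :
    a.leftmost = b.leftmost := by
  induction h with
  | refl a => rfl
  | symm _ ih => exact ih.symm
  | trans _ _ ih ih' => exact ih.trans ih'
  | lam _ ih => simp only [PreExpr.leftmost, ih]
  | app h h' ih ih' =>
    simp only [PreExpr.leftmost, ih, ih', h.toExpr_eq, h'.toExpr_eq,
      (PreExpr.Equiv.app h h').toExpr_eq]
    classical exact if_congr h.isLam rfl rfl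
  | cons r h h' ih ih' =>
    cases r <;> simp only [PreExpr.leftmost, ih, ih', h.toExpr_eq, h'.toExpr_eq]
  | swap r r' m m' p =>
    have e : ∀ (r : Mode) (m : PreExpr .term) (p : PreExpr .bag),
        (PreExpr.cons r m p).toExpr = Expr.cons r m.toExpr p.toExpr := fun _ _ _ => rfl
    cases r <;> cases r' <;>
      simp only [PreExpr.leftmost, Set.image_union, Set.image_image, e, Ctx.consTail_bag]
    · rw [Set.union_left_comm]
      simp only [Ctx.consTail_swap .linear .linear m.toExpr m'.toExpr]
    · simp only [Ctx.consTail_swap .linear .reusable m.toExpr m'.toExpr]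
    · simp only [Ctx.consTail_swap .reusable .linear m.toExpr m'.toExpr]
    · simp only [Ctx.consTail_swap .reusable .reusable m.toExpr m'.toExpr]

/-- The set `𝓛(A)` of leftmost redexes of a term or bag `A`. -/
def Expr.leftmost {s : Kind} : Expr s → Set (Occ s) :=
  Quotient.lift PreExpr.leftmost fun _ _ h => PreExpr.Equiv.leftmost h

/-! ### Reductions -/

/-- The giant step at the root, `(λx.M)P → M⟨P/x⟩{0/x}`. -/
def RootGiant (R : Term) (T : FormalSum .term) : Prop :=
  ∃ (M : Term) (P : Bag) (S : FormalSum .term),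
    R = Expr.app (Expr.lam M) P ∧ BagSubst 0 {M} P.shift S ∧ T = S.bind Expr.zeroSubst

/-- `A →g T` by firing the redex occurrence `o` of `A` (simple context closure). -/
def GiantAt {s : Kind} (o : Occ s) (A : Expr s) (T : FormalSum s) : Prop :=
  A = o.1.fill o.2 ∧ ∃ S : FormalSum .term, RootGiant o.2 S ∧ T = o.1.fillSum S

/-- `A →nd B` by firing the redex occurrence `o`: the result of the giant step is `B + 𝔸`. -/
def NDStepAt {s : Kind} (o : Occ s) (A B : Expr s) : Prop :=
  ∃ (T : FormalSum s) (U : FormalSum s), GiantAt o A T ∧ T = {B} + U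

/-- The non-deterministic reduction `A →nd B`. -/
def NDStep {s : Kind} (A B : Expr s) : Prop := ∃ o : Occ s, NDStepAt o A B

/-- `A →lm B`: an outer non-deterministic step that fires a leftmost redex. -/
def LmStep {s : Kind} (A B : Expr s) : Prop :=
  ∃ o : Occ s, NDStepAt o A B ∧ o.1.IsLinear ∧ o ∈ A.leftmost

/-- `A →¬lm B`: a non-deterministic step that fires a redex (under a `(·)^!` or not) which is not
leftmost. -/
def NonLmStep {s : Kind} (A B : Expr s) : Prop :=
  ∃ o : Occ s, NDStepAt o A B ∧ o ∉ A.leftmost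

/-- Outer normal forms: no redex but under the scope of a `(·)^!`. -/
def IsOnf {s : Kind} (A : Expr s) : Prop :=
  ∀ (C : Ctx s) (R : Term), C.IsLinear → IsRedex R → A ≠ C.fill R

/-- `N` is a may-outer-normal form of `M`. -/
def IsMonf (N M : Term) : Prop := Relation.ReflTransGen NDStep M N ∧ IsOnf N

/-- `M` is may-outer-normalizable. -/
def MayOuterNormalizable (M : Term) : Prop := ∃ N : Term, IsMonf N M

/-! ### The machine -/

mutual

/-- The statements `M ⇓ N` proved by the `ND`-machine. In `beta` and `bangBeta` one addend `M'` of
the substitution `M⟨N/x⟩ = M' + 𝔸`, resp. `M{N + x / x} = M' + 𝔸`, is chosen. -/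
inductive NDMachine : Term → Term → Prop
  | lam (M M' : Term) : NDMachine M M' → NDMachine (Expr.lam M) (Expr.lam M')
  | endRule (M : Term) : IsOnf M → NDMachine M M
  /-- Here `Qs` lists the pairs `(P_i, P'_i)`. -/
  | head (x : ℕ) (Qs : List (Bag × Bag)) : (∀ q ∈ Qs, BMachine q.1 q.2) →
      NDMachine (apps (Expr.var x) (Qs.map Prod.fst)) (apps (Expr.var x) (Qs.map Prod.snd))
  | zero (M M₀ M' : Term) (Ps : List Bag) : M.zeroSubst = {M₀} →
      NDMachine (apps M₀ Ps) M' →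
      NDMachine (apps (Expr.app (Expr.lam M) Expr.one) Ps) M'
  | beta (M N M' M'' : Term) (P : Bag) (Ps : List Bag) (U : FormalSum .term) :
      Expr.linSubst M 0 N.shift = {M'} + U →
      NDMachine (apps (Expr.app (Expr.lam M') P) Ps) M'' →
      NDMachine (apps (Expr.app (Expr.lam M) (Expr.cons .linear N P)) Ps) M''
  | bangBeta (M N M' M'' : Term) (P : Bag) (Ps : List Bag) (U : FormalSum .term) :
      Expr.partialSubst M 0 N.shift = {M'} + U →
      NDMachine (apps (Expr.app (Expr.lam M') P) Ps) M'' →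
      NDMachine (apps (Expr.app (Expr.lam M) (Expr.cons .reusable N P)) Ps) M''

/-- The statements `P ⇓b P'` proved by the auxiliary `B`-machine. -/
inductive BMachine : Bag → Bag → Prop
  | one : BMachine Expr.one Expr.one
  | lin (M N : Term) (P P' : Bag) : NDMachine M N → BMachine P P' →
      BMachine (Expr.cons .linear M P) (Expr.cons .linear N P')
  | bang (M : Term) (P P' : Bag) : BMachine P P' →
      BMachine (Expr.cons .reusable M P) (Expr.cons .reusable M P')

end

end ResourceCalculus

/-!
Every reduction `A →nd* B` can be reorganised as a standard one, which performs weak head steps and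
then proceeds in the immediate subexpressions; reusable resources are reduced as sums. To see that
standard reductions absorb a further giant step, one shows that they are closed under substitution
and under linear substitution. The latter is the derivative of the former: the chain rule and the
symmetry of the second derivative make the substitution of a bag independent of the order of its
resources, and make giant steps commute with substitutions and with their derivatives.

The machine executes a standard reduction to an outer normal form except for the part that takes
place under `(·)^!`, and this part consists of non-leftmost steps since an outer normal form has no
leftmost redexes. Conversely, the successive substitutions of resources performed by the machine
assemble into one leftmost giant step.
-/

namespace ResourceCalculus

open Relation

/-! ### Constructors -/

/-- The outermost constructor of an expression together with its arguments, which are left out for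
bags. It separates the constructors of terms, `Expr` being a quotient. -/
inductive View
  | var (n : ℕ)
  | lam (M : Term)
  | app (M : Term) (P : Bag)
  | bag

/-- The view of a raw expression. -/
def PreExpr.view : {s : Kind} → PreExpr s → View
  | _, .var n => .var n
  | _, .lam m => .lam m.toExpr
  | _, .app m p => .app m.toExpr p.toExpr
  | _, .one => .bag
  | _, .cons _ _ _ => .bag

/-- The resources of a raw bag, as a multiset. -/
def PreExpr.resources : {s : Kind} → PreExpr s → Multiset (Mode × Term)
  | _, .cons r m p => (r, m.toExpr) ::ₘ p.resources
  | _, _ => 0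

theorem PreExpr.Equiv.view {s : Kind} {a b : PreExpr s} (h : PreExpr.Equiv a b) :
    a.view = b.view := by
  induction h with
  | symm _ ih => exact ih.symm
  | trans _ _ ih ih' => exact ih.trans ih'
  | lam h _ => simp only [PreExpr.view, h.toExpr_eq]
  | app h h' _ _ => simp only [PreExpr.view, h.toExpr_eq, h'.toExpr_eq]
  | _ => rfl

theorem PreExpr.Equiv.resources {s : Kind} {a b : PreExpr s} (h : PreExpr.Equiv a b) :
    a.resources = b.resources := by
  induction h with
  | symm _ ih => exact ih.symm
  | trans _ _ ih ih' => exact ih.trans ih'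
  | cons r h _ _ ih => simp only [PreExpr.resources, h.toExpr_eq, ih]
  | swap r r' m m' p => exact Multiset.cons_swap _ _ _
  | _ => rfl

namespace Expr

/-- The view of an expression. -/
def view {s : Kind} : Expr s → View :=
  Quotient.lift PreExpr.view fun _ _ h => PreExpr.Equiv.view h

/-- The resources of a bag, as a multiset. -/
def resources {s : Kind} : Expr s → Multiset (Mode × Term) :=
  Quotient.lift PreExpr.resources fun _ _ h => PreExpr.Equiv.resources h

theorem induction {motive : ∀ s : Kind, Expr s → Prop}
    (var : ∀ n, motive .term (Expr.var n))
    (lam : ∀ M, motive .term M → motive .term (Expr.lam M))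
    (app : ∀ M P, motive .term M → motive .bag P → motive .term (Expr.app M P))
    (one : motive .bag Expr.one)
    (cons : ∀ r M P, motive .term M → motive .bag P → motive .bag (Expr.cons r M P))
    {s : Kind} (A : Expr s) : motive s A := by
  induction A using Quotient.inductionOn with
  | h a =>
    induction a with
    | var n => exact var n
    | lam m ih => exact lam _ ih
    | app m p ih ih' => exact app _ _ ih ih'
    | one => exact one
    | cons r m p ih ih' => exact cons r _ _ ih ih'

theorem bagInduction {motive : Bag → Prop} (one : motive Expr.one)
    (cons : ∀ r M P, motive P → motive (Expr.cons r M P)) (P : Bag) : motive P :=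
  Expr.induction (motive := fun s => match s with
    | .term => fun _ => True
    | .bag => motive) (fun _ => trivial) (fun _ _ => trivial) (fun _ _ _ _ => trivial) one
    (fun r M P _ h => cons r M P h) P

variable {n : ℕ} {r r' : Mode} {M M' : Term} {P P' : Bag}

@[simp] theorem view_var : (var n).view = .var n := rfl

@[simp] theorem view_lam : (lam M).view = .lam M :=
  Quotient.inductionOn M fun _ => rfl

@[simp] theorem view_app : (app M P).view = .app M P :=
  Quotient.inductionOn₂ M P fun _ _ => rfl

@[simp] theorem resources_one : one.resources = 0 := rfl

@[simp] theorem resources_cons : (cons r M P).resources = (r, M) ::ₘ P.resources :=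
  Quotient.inductionOn₂ M P fun _ _ => rfl

@[simp] theorem lam_inj : lam M = lam M' ↔ M = M' :=
  ⟨fun h => by simpa using congrArg view h, congrArg lam⟩

@[simp] theorem app_inj : app M P = app M' P' ↔ M = M' ∧ P = P' :=
  ⟨fun h => by simpa using congrArg view h, fun ⟨hM, hP⟩ => congrArg₂ app hM hP⟩

@[simp] theorem var_ne_lam : var n ≠ lam M := fun h => by simpa using congrArg view h

@[simp] theorem var_ne_app : var n ≠ app M P := fun h => by simpa using congrArg view h

@[simp] theorem lam_ne_app : lam M' ≠ app M P := fun h => by simpa using congrArg view h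

@[simp] theorem lam_ne_var : lam M ≠ var n := var_ne_lam.symm

@[simp] theorem app_ne_var : app M P ≠ var n := var_ne_app.symm

@[simp] theorem app_ne_lam : app M P ≠ lam M' := lam_ne_app.symm

@[simp] theorem one_ne_cons : one ≠ cons r M P := fun h => by
  simpa using congrArg resources h

@[simp] theorem cons_ne_one : cons r M P ≠ one := one_ne_cons.symm

instance : LeftCommutative fun (a : Mode × Term) (P : Bag) => cons a.1 a.2 P :=
  ⟨fun a b => cons_swap a.1 b.1 a.2 b.2⟩

/-- The bag with given resources: the inverse of `Expr.resources` on bags. -/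
def ofResources (R : Multiset (Mode × Term)) : Bag := R.foldr (fun a P => cons a.1 a.2 P) one

@[simp] theorem ofResources_cons (a : Mode × Term) (R : Multiset (Mode × Term)) :
    ofResources (a ::ₘ R) = cons a.1 a.2 (ofResources R) :=
  Multiset.foldr_cons _ _ _ _

theorem ofResources_resources (P : Bag) : ofResources P.resources = P := by
  induction P using bagInduction with
  | one => rfl
  | cons r M P ih => simp [ih]

theorem resources_ofResources (R : Multiset (Mode × Term)) : (ofResources R).resources = R := by
  induction R using Multiset.induction_on with
  | empty => rfl
  | cons a R ih => simp [ih]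

theorem resources_inj : P.resources = P'.resources ↔ P = P' :=
  ⟨fun h => by rw [← ofResources_resources P, h, ofResources_resources], congrArg resources⟩

theorem cons_eq_cons : cons r M P = cons r' M' P' ↔
    (r = r' ∧ M = M' ∧ P = P') ∨ ∃ Q, P = cons r' M' Q ∧ P' = cons r M Q := by
  constructor
  · intro h
    have h' := congrArg resources h
    simp only [resources_cons, Multiset.cons_eq_cons, Prod.mk.injEq, resources_inj] at h'
    rcases h' with ⟨⟨hr, hM⟩, hP⟩ | ⟨-, R, hP, hP'⟩
    · exact .inl ⟨hr, hM, hP⟩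
    · refine .inr ⟨ofResources R, ?_, ?_⟩ <;>
        simpa only [← resources_inj, resources_cons, resources_ofResources]
  · rintro (⟨rfl, rfl, rfl⟩ | ⟨Q, rfl, rfl⟩)
    · rfl
    · exact cons_swap _ _ _ _ _

end Expr

@[simp] theorem bangSum_zero (P : Bag) : bangSum 0 P = P := by simp [bangSum]

@[simp] theorem bangSum_cons_left (M : Term) (S : FormalSum .term) (P : Bag) :
    bangSum (M ::ₘ S) P = Expr.cons .reusable M (bangSum S P) := by simp [bangSum]

@[simp] theorem bangSum_singleton (M : Term) :
    bangSum {M} = Expr.cons .reusable M := by funext P; simp [bangSum]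

theorem bangSum_add (S T : FormalSum .term) (P : Bag) :
    bangSum (S + T) P = bangSum S (bangSum T P) := by
  induction S using Multiset.induction_on with
  | empty => simp
  | cons a S ih => simp [ih]

theorem bangSum_eq_cons_linear {S : FormalSum .term} {P Q : Bag} {M : Term}
    (h : bangSum S P = Expr.cons .linear M Q) :
    ∃ Q', P = Expr.cons .linear M Q' ∧ Q = bangSum S Q' := by
  induction S using Multiset.induction_on generalizing Q with
  | empty => exact ⟨Q, by simpa using h, by simp⟩
  | cons a S ih =>
    rw [bangSum_cons_left, Expr.cons_eq_cons] at h
    obtain ⟨⟨⟩, -⟩ | ⟨Q₁, h₁, rfl⟩ := h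
    obtain ⟨Q', rfl, rfl⟩ := ih h₁
    exact ⟨Q', rfl, by simp⟩

theorem bangSum_eq_cons_reusable {S : FormalSum .term} {P Q : Bag} {M : Term}
    (h : bangSum S P = Expr.cons .reusable M Q) :
    (∃ S', S = M ::ₘ S' ∧ Q = bangSum S' P) ∨
      ∃ Q', P = Expr.cons .reusable M Q' ∧ Q = bangSum S Q' := by
  induction S using Multiset.induction_on generalizing Q with
  | empty => exact .inr ⟨Q, by simpa using h, by simp⟩
  | cons a S ih =>
    rw [bangSum_cons_left, Expr.cons_eq_cons] at h
    rcases h with ⟨-, rfl, rfl⟩ | ⟨Q₁, h₁, rfl⟩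
    · exact .inl ⟨S, rfl, rfl⟩
    · rcases ih h₁ with ⟨S', rfl, rfl⟩ | ⟨Q', rfl, rfl⟩
      · exact .inl ⟨a ::ₘ S', Multiset.cons_swap _ _ _, by simp⟩
      · exact .inr ⟨Q', rfl, by simp⟩

/-! ### Operations on sums -/

section BilinearExtension

variable {α β γ δ α' β' γ' : Type*} (f : α → β → γ) (S S' : Multiset α) (T T' : Multiset β)

/-- The bilinear extension of a binary operation to sums. -/
def map₂ (f : α → β → γ) (S : Multiset α) (T : Multiset β) : Multiset γ :=
  S.bind fun a => T.map (f a)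

@[simp] theorem map₂_zero_left : map₂ f 0 T = 0 := rfl

@[simp] theorem map₂_zero_right : map₂ f S 0 = 0 := by simp [map₂]

@[simp] theorem map₂_singleton_left (a : α) : map₂ f {a} T = T.map (f a) := by simp [map₂]

@[simp] theorem map₂_singleton_right (b : β) : map₂ f S {b} = S.map (f · b) := by
  simp [map₂, Multiset.bind_singleton]

theorem map₂_add_left : map₂ f (S + S') T = map₂ f S T + map₂ f S' T := Multiset.add_bind _ _ _

theorem map₂_add_right : map₂ f S (T + T') = map₂ f S T + map₂ f S T' := by
  simp [map₂, Multiset.bind_add]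

theorem map₂_left_comm {f : α → γ → γ} (hf : ∀ a b c, f a (f b c) = f b (f a c))
    (S S' : Multiset α) (U : Multiset γ) : map₂ f S (map₂ f S' U) = map₂ f S' (map₂ f S U) := by
  simp only [map₂, Multiset.map_bind, Multiset.map_map, Function.comp_def]
  rw [Multiset.bind_bind]
  simp only [hf]

theorem bind_map₂ (h : γ → Multiset δ) :
    (map₂ f S T).bind h = S.bind fun a => T.bind fun b => h (f a b) := by
  simp [map₂, Multiset.bind_assoc, Multiset.bind_map]

theorem map_map₂_distrib {f' : α' → β' → γ'} {g : γ → γ'} {u : α → α'} {v : β → β'}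
    (h : ∀ a b, g (f a b) = f' (u a) (v b)) :
    (map₂ f S T).map g = map₂ f' (S.map u) (T.map v) := by
  simp [map₂, Multiset.map_bind, Multiset.bind_map, h]

theorem map₂_bind_bind (f' : α' → β' → γ') (u : α → Multiset α') (v : β → Multiset β') :
    map₂ f' (S.bind u) (T.bind v) = S.bind fun a => T.bind fun b => map₂ f' (u a) (v b) := by
  simp only [map₂, Multiset.bind_assoc, Multiset.map_bind]
  exact Multiset.bind_congr fun a _ => Multiset.bind_bind _ _

theorem bind_map₂_distrib {f' : α' → β' → γ'} {g : γ → Multiset γ'} {u : α → Multiset α'}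
    {v : β → Multiset β'} (h : ∀ a b, g (f a b) = map₂ f' (u a) (v b)) :
    (map₂ f S T).bind g = map₂ f' (S.bind u) (T.bind v) := by
  simp only [bind_map₂, map₂_bind_bind, h]

theorem bind_map₂_leibniz {f' : α' → β' → γ'} {g : γ → Multiset γ'} {u u' : α → Multiset α'}
    {v v' : β → Multiset β'}
    (h : ∀ a b, g (f a b) = map₂ f' (u' a) (v b) + map₂ f' (u a) (v' b)) :
    (map₂ f S T).bind g =
      map₂ f' (S.bind u') (T.bind v) + map₂ f' (S.bind u) (T.bind v') := by
  simp only [bind_map₂, map₂_bind_bind, h, Multiset.bind_add]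

end BilinearExtension

theorem map_bangSum_comm (S S' : FormalSum .term) (T : FormalSum .bag) :
    (T.map (bangSum S')).map (bangSum S) = (T.map (bangSum S)).map (bangSum S') := by
  simp only [Multiset.map_map, Function.comp_def, bangSum_comm S S']

theorem map_bangSum_map₂_cons (S S' : FormalSum .term) (T : FormalSum .bag) :
    (map₂ (Expr.cons .linear) S' T).map (bangSum S) =
      map₂ (Expr.cons .linear) S' (T.map (bangSum S)) := by
  simpa using map_map₂_distrib _ S' T (u := id) fun M P => bangSum_cons .linear S M P

/-! ### The derivative of substitution -/

/-- A direction (a sum of terms for every index), under one binder. -/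
def liftDir (D : ℕ → FormalSum .term) : ℕ → FormalSum .term
  | 0 => 0
  | n + 1 => (D n).map Expr.shift

/-- The derivative at `σ`, in the direction `D`, of substitution in a raw expression. -/
def PreExpr.dsubst :
    {s : Kind} → (ℕ → FormalSum .term) → (ℕ → FormalSum .term) → PreExpr s → FormalSum s
  | _, _, D, .var n => D n
  | _, σ, D, .lam m => (m.dsubst (liftSub σ) (liftDir D)).map Expr.lam
  | _, σ, D, .app m p =>
      map₂ Expr.app (m.dsubst σ D) (p.subst σ) + map₂ Expr.app (m.subst σ) (p.dsubst σ D)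
  | _, _, _, .one => 0
  | _, σ, D, .cons .linear m p =>
      map₂ (Expr.cons .linear) (m.dsubst σ D) (p.subst σ) +
        map₂ (Expr.cons .linear) (m.subst σ) (p.dsubst σ D)
  | _, σ, D, .cons .reusable m p =>
      map₂ (Expr.cons .linear) (m.dsubst σ D) ((p.subst σ).map (bangSum (m.subst σ))) +
        (p.dsubst σ D).map (bangSum (m.subst σ))

theorem PreExpr.subst_cons_linear (σ : ℕ → FormalSum .term) (m : PreExpr .term)
    (p : PreExpr .bag) : (PreExpr.cons .linear m p).subst σ =
      map₂ (Expr.cons .linear) (m.subst σ) (p.subst σ) := rfl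

theorem PreExpr.subst_cons_reusable (σ : ℕ → FormalSum .term) (m : PreExpr .term)
    (p : PreExpr .bag) :
    (PreExpr.cons .reusable m p).subst σ = (p.subst σ).map (bangSum (m.subst σ)) := rfl

theorem PreExpr.Equiv.dsubst {s : Kind} {a b : PreExpr s} (h : PreExpr.Equiv a b)
    (σ D : ℕ → FormalSum .term) : a.dsubst σ D = b.dsubst σ D := by
  induction h generalizing σ D with
  | refl a => rfl
  | symm _ ih => exact (ih σ D).symm
  | trans _ _ ih ih' => exact (ih σ D).trans (ih' σ D)
  | lam _ ih => simp only [PreExpr.dsubst, ih]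
  | app h h' ih ih' => simp only [PreExpr.dsubst, ih, ih', h.subst, h'.subst]
  | cons r h h' ih ih' => cases r <;> simp only [PreExpr.dsubst, ih, ih', h.subst, h'.subst]
  | swap r r' m m' p =>
    have comm := map₂_left_comm (Expr.cons_swap .linear .linear)
    cases r <;> cases r' <;>
      simp only [PreExpr.dsubst, PreExpr.subst_cons_linear, PreExpr.subst_cons_reusable,
        map₂_add_right, Multiset.map_add, map_bangSum_map₂_cons]
    · rw [comm (m.dsubst σ D), comm (m.subst σ) (m'.dsubst σ D), comm (m.subst σ) (m'.subst σ)]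
      abel
    · rw [comm (m.subst σ)]
      abel
    · rw [comm (m.dsubst σ D)]
      abel
    · simp only [map_bangSum_comm (m.subst σ) (m'.subst σ)]
      abel

/-- The derivative at `σ`, in the direction `D`, of substitution in an expression. -/
def Expr.dsubst {s : Kind} (σ D : ℕ → FormalSum .term) : Expr s → FormalSum s :=
  Quotient.lift (fun a => a.dsubst σ D) fun _ _ h => PreExpr.Equiv.dsubst h σ D

namespace Expr

variable (σ D : ℕ → FormalSum .term) (ρ : ℕ → ℕ) (r : Mode) (M : Term) (P : Bag) (x n : ℕ)
  (N : Term)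

@[simp] theorem rename_lam : (lam M).rename ρ = lam (M.rename (liftRen ρ)) :=
  Quotient.inductionOn M fun _ => rfl

@[simp] theorem rename_app : (app M P).rename ρ = app (M.rename ρ) (P.rename ρ) :=
  Quotient.inductionOn₂ M P fun _ _ => rfl

@[simp] theorem rename_one : one.rename ρ = one := rfl

@[simp] theorem rename_cons : (cons r M P).rename ρ = cons r (M.rename ρ) (P.rename ρ) :=
  Quotient.inductionOn₂ M P fun _ _ => rfl

@[simp] theorem subst_var : (var n).subst σ = σ n := rfl

@[simp] theorem subst_lam : (lam M).subst σ = (M.subst (liftSub σ)).map lam :=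
  Quotient.inductionOn M fun _ => rfl

@[simp] theorem subst_app : (app M P).subst σ = map₂ app (M.subst σ) (P.subst σ) :=
  Quotient.inductionOn₂ M P fun _ _ => rfl

@[simp] theorem subst_one : one.subst σ = {one} := rfl

@[simp] theorem subst_cons_linear :
    (cons .linear M P).subst σ = map₂ (cons .linear) (M.subst σ) (P.subst σ) :=
  Quotient.inductionOn₂ M P fun _ _ => rfl

@[simp] theorem subst_cons_reusable :
    (cons .reusable M P).subst σ = (P.subst σ).map (bangSum (M.subst σ)) :=
  Quotient.inductionOn₂ M P fun _ _ => rfl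

@[simp] theorem dsubst_var : (var n).dsubst σ D = D n := rfl

@[simp] theorem dsubst_lam :
    (lam M).dsubst σ D = (M.dsubst (liftSub σ) (liftDir D)).map lam :=
  Quotient.inductionOn M fun _ => rfl

@[simp] theorem dsubst_app : (app M P).dsubst σ D =
    map₂ app (M.dsubst σ D) (P.subst σ) + map₂ app (M.subst σ) (P.dsubst σ D) :=
  Quotient.inductionOn₂ M P fun _ _ => rfl

@[simp] theorem dsubst_one : one.dsubst σ D = 0 := rfl

@[simp] theorem dsubst_cons_linear : (cons .linear M P).dsubst σ D =
    map₂ (cons .linear) (M.dsubst σ D) (P.subst σ) +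
      map₂ (cons .linear) (M.subst σ) (P.dsubst σ D) :=
  Quotient.inductionOn₂ M P fun _ _ => rfl

@[simp] theorem dsubst_cons_reusable : (cons .reusable M P).dsubst σ D =
    map₂ (cons .linear) (M.dsubst σ D) ((P.subst σ).map (bangSum (M.subst σ))) +
      (P.dsubst σ D).map (bangSum (M.subst σ)) :=
  Quotient.inductionOn₂ M P fun _ _ => rfl

@[simp] theorem linSubst_var : (var n).linSubst x N = if n = x then {N} else 0 := rfl

@[simp] theorem linSubst_lam :
    (lam M).linSubst x N = (M.linSubst (x + 1) N.shift).map lam :=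
  Quotient.inductionOn M fun _ => rfl

@[simp] theorem linSubst_app : (app M P).linSubst x N =
    (M.linSubst x N).map (app · P) + (P.linSubst x N).map (app M) :=
  Quotient.inductionOn₂ M P fun _ _ => rfl

@[simp] theorem linSubst_cons_linear : (cons .linear M P).linSubst x N =
    (M.linSubst x N).map (cons .linear · P) + (P.linSubst x N).map (cons .linear M) :=
  Quotient.inductionOn₂ M P fun _ _ => rfl

@[simp] theorem linSubst_cons_reusable : (cons .reusable M P).linSubst x N =
    (M.linSubst x N).map (cons .linear · (cons .reusable M P)) +
      (P.linSubst x N).map (cons .reusable M) :=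
  Quotient.inductionOn₂ M P fun _ _ => rfl

variable {s : Kind} (A : Expr s)

theorem rename_rename (ρ ρ' : ℕ → ℕ) : (A.rename ρ).rename ρ' = A.rename (ρ' ∘ ρ) := by
  induction A using Expr.induction generalizing ρ ρ' with
  | var n => rfl
  | lam M ih =>
    have lift_comp : liftRen (ρ' ∘ ρ) = liftRen ρ' ∘ liftRen ρ := by funext n; cases n <;> rfl
    simp [ih, lift_comp]
  | app M P ih ih' => simp [ih, ih']
  | one => rfl
  | cons r M P ih ih' => simp [ih, ih']

theorem rename_liftRen_shift : A.shift.rename (liftRen ρ) = (A.rename ρ).shift := by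
  simp only [shift, rename_rename]
  rfl

end Expr

section SubstitutionLemmas

variable (ρ : ℕ → ℕ) (σ τ D E : ℕ → FormalSum .term)

theorem liftSub_comp_liftRen : liftSub σ ∘ liftRen ρ = liftSub (σ ∘ ρ) := by
  funext n; cases n <;> rfl

theorem liftDir_comp_liftRen : liftDir D ∘ liftRen ρ = liftDir (D ∘ ρ) := by
  funext n; cases n <;> rfl

theorem liftSub_map_rename :
    (fun n => (liftSub σ n).map (Expr.rename (liftRen ρ))) =
      liftSub fun n => (σ n).map (Expr.rename ρ) := by
  funext n
  cases n with
  | zero => rfl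
  | succ n => simp [liftSub, Expr.rename_liftRen_shift]

theorem liftDir_map_rename :
    (fun n => (liftDir D n).map (Expr.rename (liftRen ρ))) =
      liftDir fun n => (D n).map (Expr.rename ρ) := by
  funext n
  cases n with
  | zero => rfl
  | succ n => simp [liftDir, Expr.rename_liftRen_shift]

theorem rename_bangSum (S : FormalSum .term) (P : Bag) :
    (bangSum S P).rename ρ = bangSum (S.map (Expr.rename ρ)) (P.rename ρ) := by
  induction S using Multiset.induction_on with
  | empty => simp
  | cons a S ih => simp [ih]

theorem map_rename_map₂_app (S : FormalSum .term) (T : FormalSum .bag) :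
    (map₂ Expr.app S T).map (Expr.rename ρ) =
      map₂ Expr.app (S.map (Expr.rename ρ)) (T.map (Expr.rename ρ)) :=
  map_map₂_distrib _ _ _ (Expr.rename_app ρ)

theorem map_rename_map₂_cons (r : Mode) (S : FormalSum .term) (T : FormalSum .bag) :
    (map₂ (Expr.cons r) S T).map (Expr.rename ρ) =
      map₂ (Expr.cons r) (S.map (Expr.rename ρ)) (T.map (Expr.rename ρ)) :=
  map_map₂_distrib _ _ _ (Expr.rename_cons ρ r)

theorem map_rename_map_bangSum (S : FormalSum .term) (T : FormalSum .bag) :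
    (T.map (bangSum S)).map (Expr.rename ρ) =
      (T.map (Expr.rename ρ)).map (bangSum (S.map (Expr.rename ρ))) := by
  simp [rename_bangSum]

namespace Expr

variable {s : Kind} (A : Expr s)

theorem subst_rename : (A.rename ρ).subst τ = A.subst (τ ∘ ρ) := by
  induction A using Expr.induction generalizing ρ τ with
  | var n => rfl
  | lam M ih => simp [ih, liftSub_comp_liftRen]
  | app M P ih ih' => simp [ih, ih']
  | one => rfl
  | cons r M P ih ih' => cases r <;> simp [ih, ih']

theorem dsubst_rename : (A.rename ρ).dsubst τ E = A.dsubst (τ ∘ ρ) (E ∘ ρ) := by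
  induction A using Expr.induction generalizing ρ τ E with
  | var n => rfl
  | lam M ih => simp [ih, liftSub_comp_liftRen, liftDir_comp_liftRen]
  | app M P ih ih' => simp [ih, ih', subst_rename]
  | one => rfl
  | cons r M P ih ih' => cases r <;> simp [ih, ih', subst_rename]

theorem subst_shift : A.shift.subst τ = A.subst fun n => τ (n + 1) :=
  subst_rename _ _ A

theorem dsubst_shift :
    A.shift.dsubst τ E = A.dsubst (fun n => τ (n + 1)) fun n => E (n + 1) :=
  dsubst_rename _ _ _ A

theorem map_rename_subst :
    (A.subst σ).map (rename ρ) = A.subst fun n => (σ n).map (rename ρ) := by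
  induction A using Expr.induction generalizing ρ σ with
  | var n => rfl
  | lam M ih => simp [← ih, ← liftSub_map_rename]
  | app M P ih ih' => simp [map_rename_map₂_app, ih, ih']
  | one => rfl
  | cons r M P ih ih' =>
    cases r
    · simp only [subst_cons_linear, map_rename_map₂_cons, ih, ih']
    · simp only [subst_cons_reusable, map_rename_map_bangSum, ih, ih']

theorem map_rename_dsubst : (A.dsubst σ D).map (rename ρ) =
    A.dsubst (fun n => (σ n).map (rename ρ)) fun n => (D n).map (rename ρ) := by
  induction A using Expr.induction generalizing ρ σ D with
  | var n => rfl
  | lam M ih => simp [← ih, ← liftSub_map_rename, ← liftDir_map_rename]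
  | app M P ih ih' => simp [map_rename_map₂_app, ih, ih', map_rename_subst]
  | one => rfl
  | cons r M P ih ih' =>
    cases r
    · simp only [dsubst_cons_linear, Multiset.map_add, map_rename_map₂_cons, ih, ih',
        map_rename_subst]
    · simp only [dsubst_cons_reusable, Multiset.map_add, map_rename_map₂_cons,
        map_rename_map_bangSum, ih, ih', map_rename_subst]

@[simp] theorem subst_liftSub_shift : A.shift.subst (liftSub τ) = (A.subst τ).map shift := by
  rw [subst_shift]
  exact (map_rename_subst _ _ A).symm

@[simp] theorem dsubst_liftDir_shift :
    A.shift.dsubst (liftSub τ) (liftDir E) = (A.dsubst τ E).map shift := by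
  rw [dsubst_shift]
  exact (map_rename_dsubst _ _ _ A).symm

end Expr

/-! ### Composition of substitutions and their derivatives -/

theorem bind_subst_map₂_app (S : FormalSum .term) (T : FormalSum .bag) :
    (map₂ Expr.app S T).bind (Expr.subst τ) =
      map₂ Expr.app (S.bind (Expr.subst τ)) (T.bind (Expr.subst τ)) :=
  bind_map₂_distrib _ _ _ (Expr.subst_app τ)

theorem bind_subst_map₂_cons (S : FormalSum .term) (T : FormalSum .bag) :
    (map₂ (Expr.cons .linear) S T).bind (Expr.subst τ) =
      map₂ (Expr.cons .linear) (S.bind (Expr.subst τ)) (T.bind (Expr.subst τ)) :=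
  bind_map₂_distrib _ _ _ (Expr.subst_cons_linear τ)

theorem subst_bangSum (S : FormalSum .term) (P : Bag) :
    (bangSum S P).subst τ = (P.subst τ).map (bangSum (S.bind (Expr.subst τ))) := by
  induction S using Multiset.induction_on with
  | empty => simp
  | cons a S ih => simp [ih, bangSum_add]

theorem bind_subst_map_bangSum (S : FormalSum .term) (T : FormalSum .bag) :
    (T.map (bangSum S)).bind (Expr.subst τ) =
      (T.bind (Expr.subst τ)).map (bangSum (S.bind (Expr.subst τ))) := by
  simp only [Multiset.bind_map, subst_bangSum, Multiset.map_bind]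

theorem bind_dsubst_map₂_app (S : FormalSum .term) (T : FormalSum .bag) :
    (map₂ Expr.app S T).bind (Expr.dsubst τ E) =
      map₂ Expr.app (S.bind (Expr.dsubst τ E)) (T.bind (Expr.subst τ)) +
        map₂ Expr.app (S.bind (Expr.subst τ)) (T.bind (Expr.dsubst τ E)) :=
  bind_map₂_leibniz _ _ _ (Expr.dsubst_app τ E)

theorem bind_dsubst_map₂_cons (S : FormalSum .term) (T : FormalSum .bag) :
    (map₂ (Expr.cons .linear) S T).bind (Expr.dsubst τ E) =
      map₂ (Expr.cons .linear) (S.bind (Expr.dsubst τ E)) (T.bind (Expr.subst τ)) +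
        map₂ (Expr.cons .linear) (S.bind (Expr.subst τ)) (T.bind (Expr.dsubst τ E)) :=
  bind_map₂_leibniz _ _ _ (Expr.dsubst_cons_linear τ E)

theorem dsubst_bangSum (S : FormalSum .term) (P : Bag) : (bangSum S P).dsubst τ E =
    map₂ (Expr.cons .linear) (S.bind (Expr.dsubst τ E)) ((bangSum S P).subst τ) +
      (P.dsubst τ E).map (bangSum (S.bind (Expr.subst τ))) := by
  induction S using Multiset.induction_on with
  | empty => simp
  | cons a S ih =>
    simp [ih, bangSum_add, map₂_add_left, map_bangSum_map₂_cons, add_assoc, subst_bangSum]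

theorem bind_dsubst_map_bangSum (S : FormalSum .term) (T : FormalSum .bag) :
    (T.map (bangSum S)).bind (Expr.dsubst τ E) =
      map₂ (Expr.cons .linear) (S.bind (Expr.dsubst τ E))
          ((T.bind (Expr.subst τ)).map (bangSum (S.bind (Expr.subst τ)))) +
        (T.bind (Expr.dsubst τ E)).map (bangSum (S.bind (Expr.subst τ))) := by
  rw [← bind_subst_map_bangSum]
  induction T using Multiset.induction_on with
  | empty => simp
  | cons P T ih =>
    simp only [Multiset.map_cons, Multiset.cons_bind, ih, dsubst_bangSum, map₂_add_right,
      Multiset.map_add]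
    abel

theorem liftSub_bind_subst :
    (fun n => (liftSub σ n).bind (Expr.subst (liftSub τ))) =
      liftSub fun n => (σ n).bind (Expr.subst τ) := by
  funext n
  cases n with
  | zero => simp [liftSub]
  | succ n => simp [liftSub, Multiset.bind_map, Multiset.map_bind]

theorem liftDir_bind_subst :
    (fun n => (liftDir D n).bind (Expr.subst (liftSub τ))) =
      liftDir fun n => (D n).bind (Expr.subst τ) := by
  funext n
  cases n with
  | zero => simp [liftDir]
  | succ n => simp [liftDir, Multiset.bind_map, Multiset.map_bind]

theorem liftSub_bind_dsubst :
    (fun n => (liftSub σ n).bind (Expr.dsubst (liftSub τ) (liftDir E))) =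
      liftDir fun n => (σ n).bind (Expr.dsubst τ E) := by
  funext n
  cases n with
  | zero => simp [liftDir, liftSub]
  | succ n => simp [liftDir, liftSub, Multiset.bind_map, Multiset.map_bind]

theorem liftDir_bind_dsubst :
    (fun n => (liftDir D n).bind (Expr.dsubst (liftSub τ) (liftDir E))) =
      liftDir fun n => (D n).bind (Expr.dsubst τ E) := by
  funext n
  cases n with
  | zero => simp [liftDir]
  | succ n => simp [liftDir, Multiset.bind_map, Multiset.map_bind]

namespace Expr

variable {s : Kind} (A : Expr s)

theorem bind_subst_subst :
    (A.subst σ).bind (subst τ) = A.subst fun n => (σ n).bind (subst τ) := by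
  induction A using Expr.induction generalizing σ τ with
  | var n => rfl
  | lam M ih =>
    simp only [subst_lam, Multiset.bind_map, ← Multiset.map_bind, ih, liftSub_bind_subst]
  | app M P ih ih' => simp only [subst_app, bind_subst_map₂_app, ih, ih']
  | one => simp
  | cons r M P ih ih' =>
    cases r
    · simp only [subst_cons_linear, bind_subst_map₂_cons, ih, ih']
    · simp only [subst_cons_reusable, bind_subst_map_bangSum, ih, ih']

theorem bind_subst_dsubst : (A.dsubst σ D).bind (subst τ) =
    A.dsubst (fun n => (σ n).bind (subst τ)) fun n => (D n).bind (subst τ) := by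
  induction A using Expr.induction generalizing σ D τ with
  | var n => rfl
  | lam M ih =>
    simp only [dsubst_lam, subst_lam, Multiset.bind_map, ← Multiset.map_bind, ih,
      liftSub_bind_subst, liftDir_bind_subst]
  | app M P ih ih' =>
    simp only [dsubst_app, Multiset.add_bind, bind_subst_map₂_app, ih, ih', bind_subst_subst]
  | one => simp
  | cons r M P ih ih' =>
    cases r
    · simp only [dsubst_cons_linear, Multiset.add_bind, bind_subst_map₂_cons, ih, ih',
        bind_subst_subst]
    · simp only [dsubst_cons_reusable, Multiset.add_bind, bind_subst_map₂_cons,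
        bind_subst_map_bangSum, ih, ih', bind_subst_subst]

theorem bind_dsubst_subst : (A.subst σ).bind (dsubst τ E) =
    A.dsubst (fun n => (σ n).bind (subst τ)) fun n => (σ n).bind (dsubst τ E) := by
  induction A using Expr.induction generalizing σ τ E with
  | var n => rfl
  | lam M ih =>
    simp only [dsubst_lam, subst_lam, Multiset.bind_map, ← Multiset.map_bind, ih,
      liftSub_bind_subst, liftSub_bind_dsubst]
  | app M P ih ih' =>
    simp only [subst_app, dsubst_app, bind_dsubst_map₂_app, ih, ih', bind_subst_subst]
  | one => simp
  | cons r M P ih ih' =>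
    cases r
    · simp only [subst_cons_linear, dsubst_cons_linear, bind_dsubst_map₂_cons, ih, ih',
        bind_subst_subst]
    · simp only [subst_cons_reusable, dsubst_cons_reusable, bind_dsubst_map_bangSum, ih, ih',
        bind_subst_subst]

end Expr

end SubstitutionLemmas

@[simp] theorem bind_singleton_self {α : Type*} (S : Multiset α) : (S.bind fun a => {a}) = S := by
  rw [Multiset.bind_singleton, Multiset.map_id']

/-- The identity substitution. -/
def idSub (n : ℕ) : FormalSum .term := {Expr.var n}

@[simp] theorem liftSub_idSub : liftSub idSub = idSub := by
  funext n; cases n <;> rfl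

theorem liftDir_add (D E : ℕ → FormalSum .term) : liftDir (D + E) = liftDir D + liftDir E := by
  funext n; cases n <;> simp [liftDir]

@[simp] theorem liftDir_zero : liftDir 0 = 0 := by
  funext n; cases n <;> simp [liftDir]

theorem liftDir_single (x : ℕ) (S : FormalSum .term) :
    liftDir (Pi.single x S) = Pi.single (x + 1) (S.map Expr.shift) := by
  funext n
  cases n with
  | zero => simp [liftDir]
  | succ n => by_cases h : n = x <;> simp [liftDir, h]

namespace Expr

variable {s : Kind} (A : Expr s) (σ D E : ℕ → FormalSum .term)

@[simp] theorem subst_idSub : A.subst idSub = {A} := by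
  induction A using Expr.induction with
  | var n => rfl
  | lam M ih => simp [ih]
  | app M P ih ih' => simp [ih, ih']
  | one => rfl
  | cons r M P ih ih' => cases r <;> simp [ih, ih']

theorem subst_var_comp (ρ : ℕ → ℕ) : (A.subst fun n => {var (ρ n)}) = {A.rename ρ} := by
  rw [← subst_idSub (A.rename ρ), subst_rename]
  rfl

theorem dsubst_add : A.dsubst σ (D + E) = A.dsubst σ D + A.dsubst σ E := by
  induction A using Expr.induction generalizing σ D E with
  | var n => rfl
  | lam M ih => simp [liftDir_add, ih]
  | app M P ih ih' =>
    simp only [dsubst_app, ih, ih', map₂_add_left, map₂_add_right]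
    abel
  | one => rfl
  | cons r M P ih ih' =>
    cases r <;>
      simp only [dsubst_cons_linear, dsubst_cons_reusable, ih, ih', map₂_add_left,
        map₂_add_right, Multiset.map_add] <;>
      abel

@[simp] theorem dsubst_zero : A.dsubst σ 0 = 0 := by
  induction A using Expr.induction generalizing σ with
  | var n => rfl
  | lam M ih => simp [ih]
  | app M P ih ih' => simp [ih, ih']
  | one => rfl
  | cons r M P ih ih' => cases r <;> simp [ih, ih']

/-- In the second derivative of the substitution of a composite, the directions `D` and `E` are
themselves differentiated; the remaining part is symmetric. -/
theorem dsubst_dsubst_symm :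
    (A.dsubst idSub D).bind (dsubst idSub E) +
        A.dsubst idSub (fun n => (E n).bind (dsubst idSub D)) =
      (A.dsubst idSub E).bind (dsubst idSub D) +
        A.dsubst idSub fun n => (D n).bind (dsubst idSub E) := by
  induction A using Expr.induction generalizing D E with
  | var n => simp [add_comm]
  | lam M ih =>
    have h := congrArg (Multiset.map lam) (ih (liftDir D) (liftDir E))
    have lift_bind (D E : ℕ → FormalSum .term) :
        (fun n => (liftDir D n).bind (dsubst idSub (liftDir E))) =
          liftDir fun n => (D n).bind (dsubst idSub E) := by
      simpa using liftDir_bind_dsubst idSub D E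
    simpa [lift_bind, Multiset.bind_map, Multiset.map_bind] using h
  | app M P ih ih' =>
    have hM := congrArg (map₂ app · {P}) (ih D E)
    have hP := congrArg (map₂ app {M}) (ih' D E)
    simp only [map₂_add_left, map₂_add_right] at hM hP
    simp only [dsubst_app, subst_idSub, Multiset.add_bind, bind_dsubst_map₂_app,
      bind_singleton_self, Multiset.singleton_bind]
    grind
  | one => rfl
  | cons r M P ih ih' =>
    cases r
    · have hM := congrArg (map₂ (cons .linear) · {P}) (ih D E)
      have hP := congrArg (map₂ (cons .linear) {M}) (ih' D E)
      simp only [map₂_add_left, map₂_add_right] at hM hP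
      simp only [dsubst_cons_linear, subst_idSub, Multiset.add_bind, bind_dsubst_map₂_cons,
        bind_singleton_self, Multiset.singleton_bind]
      grind
    · have hM := congrArg (map₂ (cons .linear) · {bangSum {M} P}) (ih D E)
      have hP := congrArg (Multiset.map (bangSum {M})) (ih' D E)
      have comm := map₂_left_comm (cons_swap .linear .linear) (M.dsubst idSub D)
        (M.dsubst idSub E) {bangSum {M} P}
      simp only [map₂_add_left, Multiset.map_add] at hM hP
      simp only [dsubst_cons_reusable, subst_idSub, Multiset.add_bind, bind_dsubst_map₂_cons,
        bind_dsubst_map_bangSum, bind_singleton_self, Multiset.singleton_bind,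
        Multiset.map_singleton, map₂_add_right, dsubst_bangSum, subst_bangSum]
      grind

theorem dsubst_bind {α : Type*} (U : Multiset α) (f : α → ℕ → FormalSum .term) :
    (A.dsubst σ fun n => U.bind fun a => f a n) = U.bind fun a => A.dsubst σ (f a) := by
  induction U using Multiset.induction_on with
  | empty => exact A.dsubst_zero σ
  | cons a U ih =>
    simp only [Multiset.cons_bind, ← ih]
    exact A.dsubst_add σ (f a) _

theorem linSubst_eq_dsubst (x : ℕ) (N : Term) :
    A.linSubst x N = A.dsubst idSub (Pi.single x {N}) := by
  induction A using Expr.induction generalizing x N with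
  | var n => simp [Pi.single_apply]
  | lam M ih => simp [ih, liftDir_single]
  | app M P ih ih' => simp [ih, ih']
  | one => rfl
  | cons r M P ih ih' => cases r <;> simp [ih, ih']

end Expr

/-- The substitution `{S + x / x}` for the index `x = 0`. -/
def addSub (S : FormalSum .term) : ℕ → FormalSum .term
  | 0 => S + {Expr.var 0}
  | n + 1 => {Expr.var (n + 1)}

/-- The substitution `{0 / x}` for the index `x = 0` of a bound variable, whose binder is
removed. -/
def zeroSub : ℕ → FormalSum .term
  | 0 => 0
  | n + 1 => {Expr.var n}

@[simp] theorem addSub_zero : addSub 0 = idSub := by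
  funext n; cases n <;> simp [addSub, idSub]

namespace Expr

variable {s : Kind} (A : Expr s)

theorem zeroSubst_eq_subst : zeroSubst = subst (s := s) zeroSub := by
  unfold zeroSubst
  congr 1

theorem resSubst_linear (N : Term) :
    A.resSubst 0 .linear N = A.dsubst idSub (Pi.single 0 {N}) :=
  A.linSubst_eq_dsubst 0 N

theorem bind_resSubst_linear (S : FormalSum .term) :
    (S.bind fun N => A.resSubst 0 .linear N.shift) =
      A.dsubst idSub (Pi.single 0 (S.map shift)) := by
  simp only [resSubst_linear]
  rw [← dsubst_bind]
  congr 1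
  funext n
  cases n <;> simp [Multiset.bind_singleton]

theorem resSubst_reusable (N : Term) : A.resSubst 0 .reusable N = A.subst (addSub {N}) := by
  change A.partialSubst 0 N = _
  unfold partialSubst
  congr 1
  funext n
  cases n <;> simp [addSub]

@[simp] theorem subst_addSub_shift (T : FormalSum .term) :
    A.shift.subst (addSub T) = {A.shift} := by
  rw [subst_shift]
  exact A.subst_var_comp Nat.succ

@[simp] theorem subst_zeroSub_shift : A.shift.subst zeroSub = {A} := by
  rw [subst_shift]
  exact A.subst_idSub

@[simp] theorem dsubst_single_zero_shift (σ : ℕ → FormalSum .term) (T : FormalSum .term) :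
    A.shift.dsubst σ (Pi.single 0 T) = 0 := by
  rw [dsubst_shift]
  exact A.dsubst_zero _

@[simp] theorem dsubst_idSub_liftDir_shift (D : ℕ → FormalSum .term) :
    A.shift.dsubst idSub (liftDir D) = (A.dsubst idSub D).map shift := by
  simpa using A.dsubst_liftDir_shift idSub D

end Expr

theorem bind_addSub_addSub {s : Kind} (A : Expr s) (T U : FormalSum .term) :
    (A.subst (addSub (U.map Expr.shift))).bind (Expr.subst (addSub (T.map Expr.shift))) =
      A.subst (addSub ((T + U).map Expr.shift)) := by
  rw [Expr.bind_subst_subst]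
  congr 1
  funext n
  cases n with
  | zero =>
    have hU : ((U.map Expr.shift).bind (Expr.subst (addSub (T.map Expr.shift)))) =
        U.map Expr.shift := by
      simp [Multiset.bind_map, Multiset.bind_singleton]
    simp only [addSub, Multiset.add_bind, hU, Multiset.singleton_bind, Expr.subst_var,
      Multiset.map_add]
    abel
  | succ n => simp [addSub]

namespace Expr

variable {s : Kind} (A : Expr s)

theorem resSubst_linear_linear_comm (N L : Term) :
    (A.resSubst 0 .linear N.shift).bind (fun B => B.resSubst 0 .linear L.shift) =
      (A.resSubst 0 .linear L.shift).bind fun B => B.resSubst 0 .linear N.shift := by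
  have derivative_eq_zero (N L : Term) :
      (fun n => (Pi.single (M := fun _ => FormalSum .term) 0 {N.shift} n).bind
        (dsubst idSub (Pi.single 0 {L.shift}))) = 0 := by
    funext n
    cases n <;> simp
  have h := A.dsubst_dsubst_symm (Pi.single 0 {N.shift}) (Pi.single 0 {L.shift})
  simp only [resSubst_linear]
  simpa only [derivative_eq_zero, dsubst_zero, add_zero] using h

theorem resSubst_linear_reusable_comm (N L : Term) :
    (A.resSubst 0 .linear N.shift).bind (fun B => B.resSubst 0 .reusable L.shift) =
      (A.resSubst 0 .reusable L.shift).bind fun B => B.resSubst 0 .linear N.shift := by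
  simp only [resSubst_linear, resSubst_reusable, bind_subst_dsubst, bind_dsubst_subst]
  congr 1 <;> funext n <;> cases n <;> simp [addSub, idSub]

theorem resSubst_comm (r r' : Mode) (N N' : Term) :
    (A.resSubst 0 r N.shift).bind (fun B => B.resSubst 0 r' N'.shift) =
      (A.resSubst 0 r' N'.shift).bind fun B => B.resSubst 0 r N.shift := by
  cases r <;> cases r'
  · exact A.resSubst_linear_linear_comm N N'
  · exact A.resSubst_linear_reusable_comm N N'
  · exact (A.resSubst_linear_reusable_comm N' N).symm
  · have h := bind_addSub_addSub A
    simp only [resSubst_reusable, ← Multiset.map_singleton shift, h, add_comm]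

variable (σ D : ℕ → FormalSum .term) (L : Term)

theorem bind_subst_resSubst_linear :
    (A.resSubst 0 .linear L.shift).bind (subst (liftSub σ)) =
      (A.subst (liftSub σ)).bind fun B =>
        (L.subst σ).bind fun L' => B.resSubst 0 .linear L'.shift := by
  simp only [bind_resSubst_linear]
  simp only [resSubst_linear, bind_subst_dsubst, bind_dsubst_subst]
  congr 1 <;> funext n <;> cases n <;> simp [idSub, liftSub, Multiset.bind_map]

theorem bind_subst_resSubst_reusable :
    (A.resSubst 0 .reusable L.shift).bind (subst (liftSub σ)) =
      (A.subst (liftSub σ)).bind (subst (addSub ((L.subst σ).map shift))) := by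
  simp only [resSubst_reusable, bind_subst_subst]
  congr 1
  funext n
  cases n <;> simp [addSub, liftSub, Multiset.bind_map, Multiset.bind_singleton]

theorem bind_dsubst_resSubst_linear :
    (A.resSubst 0 .linear L.shift).bind (dsubst idSub (liftDir D)) =
      ((A.dsubst idSub (liftDir D)).bind fun B => B.resSubst 0 .linear L.shift) +
        (L.dsubst idSub D).bind fun L' => A.resSubst 0 .linear L'.shift := by
  have derivative_eq_zero : (fun n => (liftDir D n).bind
      (dsubst idSub (Pi.single (0 : ℕ) {L.shift}))) = 0 := by
    funext n
    cases n <;> simp [liftDir, Multiset.bind_map]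
  have derivative_eq_single :
      (fun n => (Pi.single (M := fun _ : ℕ => FormalSum .term) 0 {L.shift} n).bind
        (dsubst idSub (liftDir D))) = Pi.single (0 : ℕ) ((L.dsubst idSub D).map shift) := by
    funext n
    cases n <;> simp
  have h := A.dsubst_dsubst_symm (Pi.single 0 {L.shift}) (liftDir D)
  rw [derivative_eq_zero, derivative_eq_single, dsubst_zero, add_zero,
    ← bind_resSubst_linear] at h
  simpa only [resSubst_linear] using h

theorem bind_dsubst_resSubst_reusable :
    (A.resSubst 0 .reusable L.shift).bind (dsubst idSub (liftDir D)) =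
      ((A.dsubst idSub (liftDir D)).bind fun B => B.resSubst 0 .reusable L.shift) +
        (L.dsubst idSub D).bind fun L' =>
          (A.resSubst 0 .linear L'.shift).bind fun B => B.resSubst 0 .reusable L.shift := by
  rw [← Multiset.bind_assoc, bind_resSubst_linear]
  simp only [resSubst_reusable, bind_subst_dsubst, bind_dsubst_subst,
    ← dsubst_add]
  congr 1 <;> funext n <;> cases n <;> simp [idSub, addSub, liftDir, Multiset.bind_map]

end Expr

section BagSubstitution

variable {s : Kind}

/-- The sum `S⟨P/x⟩` for the index `x = 0`, as a function of `S`. The bag `P` lives outside of the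
binder of `x`, so that its resources do not contain `x`. -/
def bagSubst (P : Bag) (S : FormalSum s) : FormalSum s :=
  haveI : RightCommutative fun (S : FormalSum s) (a : Mode × Term) =>
      S.bind fun A => A.resSubst 0 a.1 a.2.shift :=
    ⟨fun S a b => by
      simp only [Multiset.bind_assoc, Expr.resSubst_comm _ b.1 a.1 b.2 a.2]⟩
  P.resources.foldl (fun S a => S.bind fun A => A.resSubst 0 a.1 a.2.shift) S

@[simp] theorem bagSubst_one (S : FormalSum s) : bagSubst Expr.one S = S := by simp [bagSubst]

@[simp] theorem bagSubst_cons (r : Mode) (N : Term) (P : Bag) (S : FormalSum s) :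
    bagSubst (Expr.cons r N P) S = bagSubst P (S.bind fun A => A.resSubst 0 r N.shift) := by
  simp [bagSubst]

theorem bagSubst_bind {α : Type*} (P : Bag) (U : Multiset α) (f : α → FormalSum s) :
    bagSubst P (U.bind f) = U.bind fun a => bagSubst P (f a) := by
  induction P using Expr.bagInduction generalizing f with
  | one => simp
  | cons r M P ih => simp [ih, Multiset.bind_assoc]

theorem bagSubst_add (P : Bag) (S T : FormalSum s) :
    bagSubst P (S + T) = bagSubst P S + bagSubst P T := by
  induction P using Expr.bagInduction generalizing S T with
  | one => simp
  | cons r M P ih => simp [ih]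

theorem bagSubst_bangSum (T : FormalSum .term) (P : Bag) (S : FormalSum s) :
    bagSubst (bangSum T P) S = bagSubst P (S.bind (Expr.subst (addSub (T.map Expr.shift)))) := by
  induction T using Multiset.induction_on generalizing S with
  | empty => simp
  | cons a T ih =>
    simp only [bangSum_cons_left, bagSubst_cons, ih, Expr.resSubst_reusable, Multiset.bind_assoc,
      ← Multiset.map_singleton Expr.shift, bind_addSub_addSub]
    rw [add_comm, Multiset.singleton_add]

theorem bind_subst_bagSubst (σ : ℕ → FormalSum .term) (P : Bag) (S : FormalSum s) :
    (bagSubst P S).bind (Expr.subst (liftSub σ)) =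
      (P.subst σ).bind fun P' => bagSubst P' (S.bind (Expr.subst (liftSub σ))) := by
  induction P using Expr.bagInduction generalizing S with
  | one => simp
  | cons r L P ih =>
    cases r
    · simp only [bagSubst_cons, ih, Multiset.bind_assoc, Expr.bind_subst_resSubst_linear,
        Expr.subst_cons_linear, bind_map₂]
      simp only [bagSubst_bind, Multiset.bind_bind _ (L.subst σ)]
    · simp only [bagSubst_cons, ih, Multiset.bind_assoc, Expr.bind_subst_resSubst_reusable,
        Expr.subst_cons_reusable, Multiset.bind_map, bagSubst_bangSum]

theorem bind_dsubst_bagSubst (D : ℕ → FormalSum .term) (P : Bag) (S : FormalSum s) :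
    (bagSubst P S).bind (Expr.dsubst idSub (liftDir D)) =
      bagSubst P (S.bind (Expr.dsubst idSub (liftDir D))) +
        (P.dsubst idSub D).bind fun P' => bagSubst P' S := by
  induction P using Expr.bagInduction generalizing S with
  | one => simp
  | cons r L P ih =>
    cases r
    · simp only [bagSubst_cons, ih, Multiset.bind_assoc, Expr.bind_dsubst_resSubst_linear,
        Expr.dsubst_cons_linear, Multiset.bind_add, bagSubst_add, Multiset.add_bind]
      simp [Multiset.bind_map, bagSubst_bind, add_assoc, Multiset.bind_bind S]
    · simp only [bagSubst_cons, ih, Multiset.bind_assoc, Expr.bind_dsubst_resSubst_reusable,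
        Expr.dsubst_cons_reusable, Multiset.bind_add, bagSubst_add, Multiset.add_bind]
      simp [Multiset.bind_map, bagSubst_bind, add_assoc, Multiset.bind_bind S]

/-- The giant step: the sum `S⟨P/x⟩{0/x}` for the index `x = 0`. -/
def giant (P : Bag) (S : FormalSum s) : FormalSum s := (bagSubst P S).bind Expr.zeroSubst

theorem giant_bind {α : Type*} (P : Bag) (U : Multiset α) (f : α → FormalSum s) :
    giant P (U.bind f) = U.bind fun a => giant P (f a) := by
  simp only [giant, bagSubst_bind, Multiset.bind_assoc]

theorem bind_subst_giant (σ : ℕ → FormalSum .term) (P : Bag) (S : FormalSum s) :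
    (giant P S).bind (Expr.subst σ) =
      (P.subst σ).bind fun P' => giant P' (S.bind (Expr.subst (liftSub σ))) := by
  have h : (fun A : Expr s => (A.zeroSubst).bind (Expr.subst σ)) =
      fun A => (A.subst (liftSub σ)).bind Expr.zeroSubst := by
    funext A
    simp only [Expr.zeroSubst_eq_subst, Expr.bind_subst_subst]
    congr 1
    funext n
    cases n <;> simp [zeroSub, liftSub, Multiset.bind_map, bind_singleton_self]
  simp only [giant, ← Multiset.bind_assoc, ← bind_subst_bagSubst]
  simp only [Multiset.bind_assoc, h]

theorem bind_dsubst_giant (D : ℕ → FormalSum .term) (P : Bag) (S : FormalSum s) :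
    (giant P S).bind (Expr.dsubst idSub D) =
      giant P (S.bind (Expr.dsubst idSub (liftDir D))) +
        (P.dsubst idSub D).bind fun P' => giant P' S := by
  have h : (fun A : Expr s => (A.zeroSubst).bind (Expr.dsubst idSub D)) =
      fun A => (A.dsubst idSub (liftDir D)).bind Expr.zeroSubst := by
    funext A
    simp only [Expr.zeroSubst_eq_subst, Expr.bind_subst_dsubst, Expr.bind_dsubst_subst]
    congr 1 <;> funext n <;> cases n <;> simp [zeroSub, liftDir, idSub, Multiset.bind_map,
      bind_singleton_self]
  simp only [giant, ← Multiset.bind_assoc, ← Multiset.add_bind, ← bind_dsubst_bagSubst]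
  simp only [Multiset.bind_assoc, h]

end BagSubstitution

/-! ### The giant step -/

theorem Expr.shift_eq_one {P : Bag} (h : P.shift = Expr.one) : P = Expr.one := by
  induction P using Expr.bagInduction with
  | one => rfl
  | cons r M P => simp [Expr.shift] at h

theorem Expr.shift_eq_cons {r : Mode} {N : Term} {P Q : Bag} (h : P.shift = Expr.cons r N Q) :
    ∃ N₀ P₀, P = Expr.cons r N₀ P₀ ∧ N₀.shift = N ∧ P₀.shift = Q := by
  induction P using Expr.bagInduction generalizing Q with
  | one => simp [Expr.shift] at h
  | cons r₀ M₀ P₀ ih =>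
    rw [shift, rename_cons, cons_eq_cons] at h
    rcases h with ⟨rfl, rfl, rfl⟩ | ⟨Q₁, h, rfl⟩
    · exact ⟨M₀, P₀, rfl, rfl, rfl⟩
    · obtain ⟨N₀, P₁, rfl, rfl, rfl⟩ := ih h
      exact ⟨N₀, cons r₀ M₀ P₁, cons_swap _ _ _ _ _, rfl, rename_cons _ _ _ _⟩

theorem bagSubst_iff {s : Kind} {P : Bag} {S T : FormalSum s} :
    BagSubst 0 S P.shift T ↔ T = bagSubst P S := by
  constructor
  · intro h
    generalize hQ : P.shift = Q at h
    induction h generalizing P with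
    | one S => simp [Expr.shift_eq_one hQ]
    | cons r N Q S T _ ih =>
      obtain ⟨N₀, P₀, rfl, rfl, rfl⟩ := Expr.shift_eq_cons hQ
      rw [ih rfl, bagSubst_cons]
  · rintro rfl
    induction P using Expr.bagInduction generalizing S with
    | one => rw [bagSubst_one]; exact .one S
    | cons r M P ih =>
      rw [bagSubst_cons, Expr.shift, Expr.rename_cons]
      exact .cons _ _ _ _ _ ih

theorem rootGiant_iff {R : Term} {T : FormalSum .term} :
    RootGiant R T ↔ ∃ M P, R = Expr.app (Expr.lam M) P ∧ T = giant P {M} := by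
  simp only [RootGiant, bagSubst_iff, exists_eq_left, exists_and_left, giant]

/-- The giant step `A →g T`, by structural rules: an inductive form of `∃ o, GiantAt o A T`. -/
inductive GiantStep : {s : Kind} → Expr s → FormalSum s → Prop
  | beta (M : Term) (P : Bag) : GiantStep (Expr.app (Expr.lam M) P) (giant P {M})
  | lam {M : Term} {T : FormalSum .term} :
      GiantStep M T → GiantStep (Expr.lam M) (T.map Expr.lam)
  | appL {M : Term} {T : FormalSum .term} (P : Bag) :
      GiantStep M T → GiantStep (Expr.app M P) (T.map (Expr.app · P))
  | appR {P : Bag} {T : FormalSum .bag} (M : Term) :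
      GiantStep P T → GiantStep (Expr.app M P) (T.map (Expr.app M))
  | linear {M : Term} {T : FormalSum .term} (P : Bag) :
      GiantStep M T → GiantStep (Expr.cons .linear M P) (T.map (Expr.cons .linear · P))
  | reusable {M : Term} {T : FormalSum .term} (P : Bag) :
      GiantStep M T → GiantStep (Expr.cons .reusable M P) {bangSum T P}

theorem GiantStep.fill {s : Kind} (C : Ctx s) {R : Term} {S : FormalSum .term}
    (h : RootGiant R S) : GiantStep (C.fill R) (C.fillSum S) := by
  induction C with
  | hole => obtain ⟨M, P, rfl, rfl⟩ := rootGiant_iff.1 h; exact .beta M P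
  | lam C ih => exact ih.lam
  | appL C P ih => exact ih.appL P
  | appR M C ih => exact ih.appR M
  | bag r C P ih => cases r; exacts [ih.linear P, ih.reusable P]

theorem giantStep_iff {s : Kind} {A : Expr s} {T : FormalSum s} :
    GiantStep A T ↔ ∃ o, GiantAt o A T := by
  constructor
  · intro h
    induction h with
    | beta M P => exact ⟨(.hole, _), rfl, _, rootGiant_iff.2 ⟨M, P, rfl, rfl⟩, rfl⟩
    | lam _ ih => obtain ⟨⟨C, R⟩, rfl, S, hS, rfl⟩ := ih; exact ⟨(.lam C, R), rfl, S, hS, rfl⟩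
    | appL P _ ih =>
      obtain ⟨⟨C, R⟩, rfl, S, hS, rfl⟩ := ih; exact ⟨(.appL C P, R), rfl, S, hS, rfl⟩
    | appR M _ ih =>
      obtain ⟨⟨C, R⟩, rfl, S, hS, rfl⟩ := ih; exact ⟨(.appR M C, R), rfl, S, hS, rfl⟩
    | linear P _ ih =>
      obtain ⟨⟨C, R⟩, rfl, S, hS, rfl⟩ := ih; exact ⟨(.bag .linear C P, R), rfl, S, hS, rfl⟩
    | reusable P _ ih =>
      obtain ⟨⟨C, R⟩, rfl, S, hS, rfl⟩ := ih; exact ⟨(.bag .reusable C P, R), rfl, S, hS, rfl⟩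
  · rintro ⟨⟨C, R⟩, rfl, S, hS, rfl⟩
    exact .fill C hS

theorem ndStep_iff {s : Kind} {A B : Expr s} : NDStep A B ↔ ∃ T, GiantStep A T ∧ B ∈ T := by
  simp only [NDStep, NDStepAt, giantStep_iff]
  constructor
  · rintro ⟨o, T, U, h, rfl⟩
    exact ⟨_, ⟨o, h⟩, by simp⟩
  · rintro ⟨T, ⟨o, h⟩, hB⟩
    obtain ⟨U, rfl⟩ := Multiset.exists_cons_of_mem hB
    exact ⟨o, _, U, h, (Multiset.singleton_add _ _).symm⟩

theorem GiantStep.cons {P : Bag} {T : FormalSum .bag} (h : GiantStep P T) (r : Mode)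
    (M : Term) : GiantStep (Expr.cons r M P) (T.map (Expr.cons r M)) := by
  obtain ⟨⟨C, R⟩, rfl, S, hS, rfl⟩ := giantStep_iff.1 h
  cases C with
  | bag r' C Q =>
    have h := GiantStep.fill (C.bag r' (Expr.cons r M Q)) hS
    cases r'
    · simpa [Ctx.fill, Ctx.fillSum, Expr.cons_swap, Multiset.map_map] using h
    · simpa [Ctx.fill, Ctx.fillSum, Expr.cons_swap _ r, bangSum_cons] using h

theorem GiantStep.bangSum_right {P : Bag} {T : FormalSum .bag} (h : GiantStep P T)
    (S : FormalSum .term) : GiantStep (bangSum S P) (T.map (bangSum S)) := by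
  induction S using Multiset.induction_on with
  | empty => simpa
  | cons a S ih => simpa [Multiset.map_map, Function.comp_def] using ih.cons .reusable a

/-! ### Reduction of sums -/

/-- A giant step in one addend of a sum. -/
inductive SumStep {s : Kind} : FormalSum s → FormalSum s → Prop
  | mk {A : Expr s} {T : FormalSum s} (U : FormalSum s) :
      GiantStep A T → SumStep (A ::ₘ U) (T + U)

theorem SumStep.bangSum {S S' : FormalSum .term} (h : SumStep S S') (P : Bag) :
    GiantStep (bangSum S P) {ResourceCalculus.bangSum S' P} := by
  obtain ⟨V, h⟩ := h
  rw [bangSum_cons_left, bangSum_add]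
  exact h.reusable _

/-- Reduction of sums: finitely many giant steps, each in one addend. Inside a `(·)^!`, whose
content is itself a sum, this is what a sequence of `→nd` steps does. -/
def SumRed {s : Kind} : FormalSum s → FormalSum s → Prop := ReflTransGen SumStep

namespace SumRed

variable {s t u : Kind} {S S' T T' U : FormalSum s}

theorem refl (S : FormalSum s) : SumRed S S := ReflTransGen.refl

theorem trans (h : SumRed S T) (h' : SumRed T U) : SumRed S U := ReflTransGen.trans h h'

theorem of_giantStep {A : Expr s} (h : GiantStep A T) : SumRed {A} T := by
  have h := SumStep.mk 0 h
  rw [add_zero] at h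
  exact .single h

theorem add_right (h : SumRed S T) (U : FormalSum s) : SumRed (S + U) (T + U) := by
  refine ReflTransGen.lift (· + U) ?_ _ _ h
  rintro _ _ ⟨V, h⟩
  simpa only [Function.onFun, Multiset.cons_add, add_assoc] using SumStep.mk (V + U) h

theorem add (h : SumRed S T) (h' : SumRed S' T') : SumRed (S + S') (T + T') := by
  refine (h.add_right S').trans ?_
  rw [add_comm T, add_comm T]
  exact h'.add_right T

theorem bind_congr {α : Type*} (V : Multiset α) {f g : α → FormalSum s}
    (h : ∀ a, SumRed (f a) (g a)) : SumRed (V.bind f) (V.bind g) := by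
  induction V using Multiset.induction_on with
  | empty => exact refl _
  | cons a V ih => simpa using (h a).add ih

theorem bind {f : Expr s → FormalSum t} (hf : ∀ A T, GiantStep A T → SumRed (f A) (T.bind f))
    (h : SumRed S T) : SumRed (S.bind f) (T.bind f) := by
  induction h with
  | refl => exact refl _
  | tail _ h ih =>
    obtain ⟨V, h⟩ := h
    rw [Multiset.cons_bind] at ih
    rw [Multiset.add_bind]
    exact ih.trans ((hf _ _ h).add_right _)

theorem map {f : Expr s → Expr t} (hf : ∀ A T, GiantStep A T → GiantStep (f A) (T.map f))
    (h : SumRed S T) : SumRed (S.map f) (T.map f) := by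
  simp only [← Multiset.bind_singleton]
  exact h.bind fun A T hA => by simpa only [Multiset.bind_singleton] using of_giantStep (hf A T hA)

theorem lam {S T : FormalSum .term} (h : SumRed S T) : SumRed (S.map Expr.lam) (T.map Expr.lam) :=
  h.map fun _ _ => .lam

theorem map₂ {f : Expr s → Expr t → Expr u} {T T' : FormalSum t}
    (hf : ∀ A V B, GiantStep A V → GiantStep (f A B) (V.map (f · B)))
    (hf' : ∀ A B V, GiantStep B V → GiantStep (f A B) (V.map (f A)))
    (h : SumRed S S') (h' : SumRed T T') :
    SumRed (map₂ f S T) (ResourceCalculus.map₂ f S' T') := by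
  refine (bind_congr S fun A => h'.map (hf' A)).trans ?_
  simp only [Multiset.bind_map_comm S, ResourceCalculus.map₂, Multiset.bind_map_comm S']
  exact bind_congr T' fun B => h.map (hf · · B)

theorem app {S S' : FormalSum .term} {T T' : FormalSum .bag} (h : SumRed S S')
    (h' : SumRed T T') :
    SumRed (ResourceCalculus.map₂ Expr.app S T) (ResourceCalculus.map₂ Expr.app S' T') :=
  h.map₂ (fun _ _ B => .appL B) (fun A _ _ => .appR A) h'

theorem consLinear {S S' : FormalSum .term} {T T' : FormalSum .bag} (h : SumRed S S')
    (h' : SumRed T T') :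
    SumRed (ResourceCalculus.map₂ (Expr.cons .linear) S T)
      (ResourceCalculus.map₂ (Expr.cons .linear) S' T') :=
  h.map₂ (fun _ _ B => .linear B) (fun A _ _ hV => hV.cons .linear A) h'

theorem bangSum_left {S S' : FormalSum .term} (h : SumRed S S') (P : Bag) :
    SumRed {bangSum S P} {bangSum S' P} :=
  ReflTransGen.trans_induction_on h (fun _ => refl _)
    (fun h => of_giantStep (h.bangSum P)) fun _ _ => trans

theorem bang {S S' : FormalSum .term} {T T' : FormalSum .bag} (h : SumRed S S')
    (h' : SumRed T T') : SumRed (T.map (bangSum S)) (T'.map (bangSum S')) := by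
  refine SumRed.trans (T := T.map (bangSum S')) ?_ (h'.map fun _ _ hV => hV.bangSum_right S')
  simp only [← Multiset.bind_singleton]
  exact bind_congr T h.bangSum_left

end SumRed

theorem giant_eq_bind {s : Kind} (P : Bag) (S : FormalSum s) :
    giant P S = S.bind fun A => giant P {A} := by
  rw [← giant_bind, bind_singleton_self]

theorem mem_giant {s : Kind} {P : Bag} {S : FormalSum s} {K : Expr s} :
    K ∈ giant P S ↔ ∃ A ∈ S, K ∈ giant P {A} := by
  rw [giant_eq_bind, Multiset.mem_bind]

section

variable {s : Kind} {S T : FormalSum s} {σ τ : ℕ → FormalSum .term}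

theorem GiantStep.subst {A : Expr s} (h : GiantStep A T) (σ : ℕ → FormalSum .term) :
    SumRed (A.subst σ) (T.bind (Expr.subst σ)) := by
  induction h generalizing σ with
  | beta M P =>
    rw [bind_subst_giant, Expr.subst_app, Expr.subst_lam, map₂, Multiset.bind_map_comm]
    refine SumRed.bind_congr _ fun P' => ?_
    rw [giant_eq_bind, Multiset.singleton_bind, Multiset.map_map, ← Multiset.bind_singleton]
    exact SumRed.bind_congr _ fun M' => .of_giantStep (.beta M' P')
  | lam _ ih =>
    rw [Expr.subst_lam]
    simpa only [Multiset.bind_map, Multiset.map_bind, Expr.subst_lam] using (ih _).lam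
  | appL P _ ih =>
    rw [Expr.subst_app, ← map₂_singleton_right, bind_subst_map₂_app, Multiset.singleton_bind]
    exact (ih σ).app (.refl _)
  | appR M _ ih =>
    rw [Expr.subst_app, ← map₂_singleton_left, bind_subst_map₂_app, Multiset.singleton_bind]
    exact SumRed.app (.refl _) (ih σ)
  | linear P _ ih =>
    rw [Expr.subst_cons_linear, ← map₂_singleton_right, bind_subst_map₂_cons,
      Multiset.singleton_bind]
    exact (ih σ).consLinear (.refl _)
  | reusable P _ ih =>
    rw [Expr.subst_cons_reusable, Multiset.singleton_bind, subst_bangSum]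
    exact (ih σ).bang (.refl _)

theorem SumRed.subst (h : SumRed S T) (σ : ℕ → FormalSum .term) :
    SumRed (S.bind (Expr.subst σ)) (T.bind (Expr.subst σ)) :=
  h.bind fun _ _ h => h.subst σ

theorem SumRed.map_rename (h : SumRed S T) (ρ : ℕ → ℕ) :
    SumRed (S.map (Expr.rename ρ)) (T.map (Expr.rename ρ)) := by
  simpa [Expr.subst_var_comp, Multiset.bind_singleton] using h.subst fun n => {Expr.var (ρ n)}

theorem SumRed.liftSub (h : ∀ n, SumRed (σ n) (τ n)) (n : ℕ) :
    SumRed (liftSub σ n) (ResourceCalculus.liftSub τ n) := by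
  cases n
  exacts [.refl _, (h _).map_rename _]

theorem Expr.subst_sumRed (A : Expr s) (h : ∀ n, SumRed (σ n) (τ n)) :
    SumRed (A.subst σ) (A.subst τ) := by
  induction A using Expr.induction generalizing σ τ with
  | var n => exact h n
  | lam M ih => rw [subst_lam, subst_lam]; exact (ih (SumRed.liftSub h)).lam
  | app M P ih ih' => rw [subst_app, subst_app]; exact (ih h).app (ih' h)
  | one => exact .refl _
  | cons r M P ih ih' =>
    cases r
    · rw [subst_cons_linear, subst_cons_linear]; exact (ih h).consLinear (ih' h)
    · rw [subst_cons_reusable, subst_cons_reusable]; exact (ih h).bang (ih' h)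

theorem SumRed.subst_congr (h : SumRed S T) (hσ : ∀ n, SumRed (σ n) (τ n)) :
    SumRed (S.bind (Expr.subst σ)) (T.bind (Expr.subst τ)) :=
  (h.subst σ).trans (SumRed.bind_congr T fun A => A.subst_sumRed hσ)

end

/-! ### Covering relations between sums -/

section Covers

variable {α β γ α' β' γ' : Type*} {r : α → α' → Prop} {q : β → β' → Prop} {p : γ → γ' → Prop}

/-- The lifting of a relation to sums in which every addend of the target has an antecedent in the
source. Addends of the source may be left over: `→nd` keeps only one addend at each step. -/
def Covers (r : α → α' → Prop) (S : Multiset α) (S' : Multiset α') : Prop :=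
  ∀ b ∈ S', ∃ a ∈ S, r a b

theorem Covers.refl {r : α → α → Prop} (hr : ∀ a, r a a) (S : Multiset α) : Covers r S S :=
  fun a ha => ⟨a, ha, hr a⟩

theorem Covers.singleton {a : α} {b : α'} (h : r a b) : Covers r {a} {b} := by
  simpa [Covers] using h

theorem Covers.mono_right {S : Multiset α} {S' T' : Multiset α'} (h : Covers r S S')
    (hT : T' ⊆ S') : Covers r S T' :=
  fun b hb => h b (hT hb)

theorem Covers.trans {a : α → β → Prop} {b : β → γ → Prop} {c : α → γ → Prop}
    {S : Multiset α} {T : Multiset β} {U : Multiset γ} (h : Covers a S T) (h' : Covers b T U)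
    (habc : ∀ {x y z}, a x y → b y z → c x z) : Covers c S U := fun z hz => by
  obtain ⟨y, hy, hyz⟩ := h' z hz
  obtain ⟨x, hx, hxy⟩ := h y hy
  exact ⟨x, hx, habc hxy hyz⟩

theorem Covers.add {S T : Multiset α} {S' T' : Multiset α'} (h : Covers r S S')
    (h' : Covers r T T') : Covers r (S + T) (S' + T') := fun b hb => by
  rcases Multiset.mem_add.1 hb with hb | hb
  · obtain ⟨a, ha, hab⟩ := h b hb
    exact ⟨a, Multiset.mem_add.2 (.inl ha), hab⟩
  · obtain ⟨a, ha, hab⟩ := h' b hb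
    exact ⟨a, Multiset.mem_add.2 (.inr ha), hab⟩

theorem Covers.bind {S : Multiset α} {S' : Multiset α'} {f : α → Multiset β}
    {g : α' → Multiset β'} (h : Covers r S S') (hfg : ∀ {a b}, r a b → Covers q (f a) (g b)) :
    Covers q (S.bind f) (S'.bind g) := fun c hc => by
  obtain ⟨b, hb, hc⟩ := Multiset.mem_bind.1 hc
  obtain ⟨a, ha, hab⟩ := h b hb
  obtain ⟨d, hd, hdc⟩ := hfg hab c hc
  exact ⟨d, Multiset.mem_bind.2 ⟨a, ha, hd⟩, hdc⟩

theorem Covers.bind_congr (V : Multiset α) {f : α → Multiset β} {g : α → Multiset β'}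
    (h : ∀ a, Covers q (f a) (g a)) : Covers q (V.bind f) (V.bind g) :=
  (Covers.refl (r := Eq) (fun _ => rfl) V).bind fun | rfl => h _

theorem Covers.map {S : Multiset α} {S' : Multiset α'} {f : α → β} {g : α' → β'}
    (h : Covers r S S') (hfg : ∀ {a b}, r a b → q (f a) (g b)) : Covers q (S.map f) (S'.map g) := by
  simpa only [Multiset.bind_singleton] using h.bind (q := q) fun hab => .singleton (hfg hab)

theorem Covers.map₂ {S : Multiset α} {S' : Multiset α'} {T : Multiset β} {T' : Multiset β'}
    {f : α → β → γ} {g : α' → β' → γ'} (h : Covers r S S') (h' : Covers q T T')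
    (hfg : ∀ {a b c d}, r a b → q c d → p (f a c) (g b d)) :
    Covers p (map₂ f S T) (ResourceCalculus.map₂ g S' T') :=
  h.bind fun hab => h'.map (hfg hab)

theorem Covers.reflTransGen {r : α → α → Prop} {q : β → β → Prop} {f : α → Multiset β}
    (hf : ∀ {a b}, r a b → Covers q (f a) (f b)) {a b : α} (h : ReflTransGen r a b) :
    Covers (ReflTransGen q) (f a) (f b) := by
  induction h with
  | refl => exact .refl (fun _ => .refl) _
  | tail _ h ih => exact ih.trans (hf h) .tail

end Covers

/-! ### Weak head reduction -/

/-- One step of weak head reduction: the redex `(λx.M)P` in head position of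
`(λx.M) P P₁ … P_m` is fired by a giant step, of whose result one addend is kept. -/
inductive WeakHead : Term → Term → Prop
  | beta {M R : Term} {P : Bag} : R ∈ giant P {M} → WeakHead (Expr.app (Expr.lam M) P) R
  | app {M M' : Term} (P : Bag) : WeakHead M M' → WeakHead (Expr.app M P) (Expr.app M' P)

theorem covers_weakHead_giant (S : FormalSum .term) (P : Bag) :
    Covers WeakHead ((S.map Expr.lam).map (Expr.app · P)) (giant P S) := fun R hR => by
  obtain ⟨M, hM, hR⟩ := mem_giant.1 hR
  exact ⟨_, Multiset.mem_map_of_mem _ (Multiset.mem_map_of_mem _ hM), .beta hR⟩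

namespace WeakHead

variable {M M' : Term}

theorem subst (h : WeakHead M M') (σ : ℕ → FormalSum .term) :
    Covers WeakHead (M.subst σ) (M'.subst σ) := by
  induction h with
  | @beta M R P hR =>
    refine Covers.mono_right (S' := (giant P {M}).bind (Expr.subst σ)) ?_
      fun K hK => Multiset.mem_bind.2 ⟨R, hR, hK⟩
    rw [bind_subst_giant, Multiset.singleton_bind, Expr.subst_app, Expr.subst_lam, map₂,
      Multiset.bind_map_comm]
    exact .bind_congr _ fun P' => covers_weakHead_giant _ P'
  | app P _ ih =>
    rw [Expr.subst_app, Expr.subst_app]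
    exact ih.map₂ (.refl (r := Eq) (fun _ => rfl) _) fun h e => e ▸ h.app _

theorem dsubst (h : WeakHead M M') (D : ℕ → FormalSum .term) :
    Covers WeakHead (M.dsubst idSub D) (M'.dsubst idSub D) := by
  induction h with
  | @beta M R P hR =>
    refine Covers.mono_right (S' := (giant P {M}).bind (Expr.dsubst idSub D)) ?_
      fun K hK => Multiset.mem_bind.2 ⟨R, hR, hK⟩
    simp only [bind_dsubst_giant, Multiset.singleton_bind, Expr.dsubst_app, Expr.dsubst_lam,
      liftSub_idSub, Expr.subst_idSub, map₂_singleton_left, map₂_singleton_right]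
    refine (covers_weakHead_giant _ P).add ?_
    rw [← Multiset.bind_singleton]
    exact .bind_congr _ fun P' => covers_weakHead_giant {M} P'
  | @app M M' P h ih =>
    simp only [Expr.dsubst_app, Expr.subst_idSub, map₂_singleton_left, map₂_singleton_right]
    refine (ih.map (.app P)).add ?_
    simp only [← Multiset.bind_singleton]
    exact .bind_congr _ fun P' => .singleton (h.app P')

theorem rename (h : WeakHead M M') (ρ : ℕ → ℕ) : WeakHead (M.rename ρ) (M'.rename ρ) := by
  simpa [Expr.subst_var_comp, Covers] using h.subst fun n => {Expr.var (ρ n)}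

end WeakHead

/-! ### Standard reductions -/

/-- Standard reductions: weak head reduction, followed by standard reductions of the immediate
subexpressions. The reusable resources of a bag are reduced as a sum `U`, by arbitrary giant steps,
subject to the condition that every addend `N` of the result `T` is also reached by a standard
reduction from an addend `f N` of `U`; this is `Covers Standard U T`, expressed through a choice
function because an inductive predicate cannot occur under the `∃` of `Covers`. -/
inductive Standard : {s : Kind} → Expr s → Expr s → Prop
  | var {M : Term} {n : ℕ} : ReflTransGen WeakHead M (Expr.var n) → Standard M (Expr.var n)
  | lam {M A A' : Term} :
      ReflTransGen WeakHead M (Expr.lam A) → Standard A A' → Standard M (Expr.lam A')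
  | app {M A A' : Term} {P P' : Bag} : ReflTransGen WeakHead M (Expr.app A P) →
      Standard A A' → Standard P P' → Standard M (Expr.app A' P')
  | one : Standard Expr.one Expr.one
  | linear {M M' : Term} {P P' : Bag} : Standard M M' → Standard P P' →
      Standard (Expr.cons .linear M P) (Expr.cons .linear M' P')
  | reusable {U T : FormalSum .term} {P P' : Bag} (f : Term → Term) : SumRed U T →
      (∀ N ∈ T, f N ∈ U) → (∀ N ∈ T, Standard (f N) N) → Standard P P' →
      Standard (bangSum U P) (bangSum T P')

namespace Standard

theorem bang {U T : FormalSum .term} {P P' : Bag} (h : SumRed U T) (hUT : Covers Standard U T)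
    (hP : Standard P P') : Standard (bangSum U P) (bangSum T P') := by
  have : Inhabited Term := ⟨Expr.var 0⟩
  choose! f hf hf' using hUT
  exact .reusable f h hf hf' hP

@[elab_as_elim]
theorem bagInduction {motive : (P P' : Bag) → Standard P P' → Prop}
    (one : motive _ _ .one)
    (linear : ∀ {M M' P P'} (hM : Standard M M') (hP : Standard P P'),
      motive P P' hP → motive _ _ (.linear hM hP))
    (bang : ∀ {U T P P'} (h : SumRed U T) (hUT : Covers Standard U T) (hP : Standard P P'),
      motive P P' hP → motive _ _ (.bang h hUT hP))
    {P P' : Bag} (h : Standard P P') : motive P P' h := by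
  suffices ∀ {s : Kind} {A B : Expr s} (h : Standard A B), match s, A, B, h with
      | .term, _, _, _ => True
      | .bag, P, P', h => motive P P' h from this h
  intro s A B h
  induction h with
  | var | lam | app => trivial
  | one => exact one
  | linear hM hP _ ih => exact linear hM hP ih
  | reusable f h hf hf' hP _ ih => exact bang h (fun N hN => ⟨f N, hf N hN, hf' N hN⟩) hP ih

theorem refl {s : Kind} (A : Expr s) : Standard A A := by
  induction A using Expr.induction with
  | var n => exact .var .refl
  | lam M ih => exact .lam .refl ih
  | app M P ih ih' => exact .app .refl ih ih'
  | one => exact .one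
  | cons r M P ih ih' =>
    cases r
    · exact .linear ih ih'
    · simpa using bang (.refl {M}) (.singleton ih) ih'

theorem covers_refl {s : Kind} (S : FormalSum s) : Covers Standard S S := .refl refl S

theorem expand {M M₁ N : Term} (h : ReflTransGen WeakHead M M₁) (h₁ : Standard M₁ N) :
    Standard M N := by
  cases h₁ with
  | var h' => exact .var (h.trans h')
  | lam h' hA => exact .lam (h.trans h') hA
  | app h' hA hP => exact .app (h.trans h') hA hP

theorem lam_inv {M A' : Term} (h : Standard M (Expr.lam A')) :
    ∃ A, ReflTransGen WeakHead M (Expr.lam A) ∧ Standard A A' := by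
  generalize e : Expr.lam A' = N at h
  cases h with
  | var h => simp at e
  | lam h hA => obtain rfl := Expr.lam_inj.1 e; exact ⟨_, h, hA⟩
  | app h hA hP => simp at e

theorem app_inv {M A' : Term} {P' : Bag} (h : Standard M (Expr.app A' P')) :
    ∃ A P, ReflTransGen WeakHead M (Expr.app A P) ∧ Standard A A' ∧ Standard P P' := by
  generalize e : Expr.app A' P' = N at h
  cases h with
  | var h => simp at e
  | lam h hA => simp at e
  | app h hA hP => obtain ⟨rfl, rfl⟩ := Expr.app_inj.1 e; exact ⟨_, _, h, hA, hP⟩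

theorem linear_inv {P M' Q'} (h : Standard P (Expr.cons .linear M' Q')) :
    ∃ M Q, P = Expr.cons .linear M Q ∧ Standard M M' ∧ Standard Q Q' := by
  generalize e : Expr.cons .linear M' Q' = P' at h
  induction h using bagInduction generalizing Q' with
  | one => simp at e
  | linear hM hP ih =>
    rcases Expr.cons_eq_cons.1 e.symm with ⟨-, rfl, rfl⟩ | ⟨Q₁, rfl, rfl⟩
    · exact ⟨_, _, rfl, hM, hP⟩
    · obtain ⟨M, Q, rfl, hM', hQ⟩ := ih rfl
      exact ⟨M, _, Expr.cons_swap _ _ _ _ _, hM', .linear hM hQ⟩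
  | bang h hUT hP ih =>
    obtain ⟨Q', rfl, rfl⟩ := bangSum_eq_cons_linear e.symm
    obtain ⟨M, Q, rfl, hM', hQ⟩ := ih rfl
    exact ⟨M, _, bangSum_cons _ _ _ _, hM', .bang h hUT hQ⟩

theorem reusable_inv {P M' Q'} (h : Standard P (Expr.cons .reusable M' Q')) :
    ∃ U T R R', P = bangSum U R ∧ Q' = bangSum T R' ∧ SumRed U (M' ::ₘ T) ∧
      Covers Standard U (M' ::ₘ T) ∧ Standard R R' := by
  generalize e : Expr.cons .reusable M' Q' = P' at h
  induction h using bagInduction generalizing Q' with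
  | one => simp at e
  | linear hM hP ih =>
    rcases Expr.cons_eq_cons.1 e.symm with ⟨h, -⟩ | ⟨Q₁, rfl, rfl⟩
    · cases h
    · obtain ⟨U, T, R, R', rfl, rfl, hU, hUT, hR⟩ := ih rfl
      exact ⟨U, T, _, _, (bangSum_cons _ _ _ _).symm, (bangSum_cons _ _ _ _).symm, hU, hUT,
        .linear hM hR⟩
  | bang h hUT hP ih =>
    rcases bangSum_eq_cons_reusable e.symm with ⟨T', rfl, rfl⟩ | ⟨Q', rfl, rfl⟩
    · exact ⟨_, T', _, _, rfl, rfl, h, hUT, hP⟩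
    · obtain ⟨U', T', R, R', rfl, rfl, hU', hUT', hR⟩ := ih rfl
      exact ⟨U', T', _, _, bangSum_comm _ _ _, bangSum_comm _ _ _, hU', hUT', .bang h hUT hR⟩

end Standard

namespace Standard

variable {s : Kind} {A A' : Expr s} {σ σ' D D' : ℕ → FormalSum .term}

theorem rename (h : Standard A A') (ρ : ℕ → ℕ) : Standard (A.rename ρ) (A'.rename ρ) := by
  have star {M M' : Term} (ρ : ℕ → ℕ) (h : ReflTransGen WeakHead M M') :
      ReflTransGen WeakHead (M.rename ρ) (M'.rename ρ) :=
    ReflTransGen.lift (Expr.rename ρ) (fun _ _ h => h.rename ρ) _ _ h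
  induction h generalizing ρ with
  | var h => exact .var (star ρ h)
  | lam h _ ih =>
    have h := star ρ h
    rw [Expr.rename_lam] at h ⊢
    exact .lam h (ih _)
  | app h _ _ ih ih' =>
    have h := star ρ h
    rw [Expr.rename_app] at h ⊢
    exact .app h (ih ρ) (ih' ρ)
  | one => exact .one
  | linear _ _ ih ih' => rw [Expr.rename_cons, Expr.rename_cons]; exact .linear (ih ρ) (ih' ρ)
  | reusable f h hf _ _ ih ih' =>
    rw [rename_bangSum, rename_bangSum]
    refine bang (h.map_rename ρ) (fun N hN => ?_) (ih' ρ)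
    obtain ⟨N, hN', rfl⟩ := Multiset.mem_map.1 hN
    exact ⟨_, Multiset.mem_map_of_mem _ (hf N hN'), ih N hN' ρ⟩

theorem covers_liftSub (h : ∀ n, Covers Standard (σ n) (σ' n)) (n : ℕ) :
    Covers Standard (liftSub σ n) (liftSub σ' n) := by
  cases n
  exacts [covers_refl _, (h _).map (rename · _)]

theorem covers_liftDir (h : ∀ n, Covers Standard (D n) (D' n)) (n : ℕ) :
    Covers Standard (liftDir D n) (liftDir D' n) := by
  cases n
  exacts [covers_refl _, (h _).map (rename · _)]

theorem covers_dsubst (h : Standard A A') (hD : ∀ n, Covers Standard (D n) (D' n)) :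
    Covers Standard (A.dsubst idSub D) (A'.dsubst idSub D') := by
  have star {M M' : Term} (h : ReflTransGen WeakHead M M') (D : ℕ → FormalSum .term) :
      Covers (ReflTransGen WeakHead) (M.dsubst idSub D) (M'.dsubst idSub D) :=
    .reflTransGen (f := Expr.dsubst idSub D) (fun h => h.dsubst D) h
  induction h generalizing D D' with
  | var h => exact (star h D).trans (by simpa using hD _) expand
  | lam h _ ih =>
    refine (star h D).trans ?_ expand
    simp only [Expr.dsubst_lam, liftSub_idSub]
    exact (ih (covers_liftDir hD)).map (.lam .refl)
  | app h hA hP ih ih' =>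
    refine (star h D).trans ?_ expand
    simp only [Expr.dsubst_app, Expr.subst_idSub]
    exact ((ih hD).map₂ (.singleton hP) (.app .refl)).add
      ((Covers.singleton hA).map₂ (ih' hD) (.app .refl))
  | one => simpa using covers_refl 0
  | linear hM hP ih ih' =>
    simp only [Expr.dsubst_cons_linear, Expr.subst_idSub]
    exact ((ih hD).map₂ (.singleton hP) .linear).add
      ((Covers.singleton hM).map₂ (ih' hD) .linear)
  | @reusable U T P P' f h hf hf' hP ih ih' =>
    have hUT : Covers Standard U T := fun N hN => ⟨f N, hf N hN, hf' N hN⟩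
    have hUT' : Covers Standard (U.bind (Expr.dsubst idSub D)) (T.bind (Expr.dsubst idSub D')) :=
      fun K hK => by
        obtain ⟨N, hN, hK⟩ := Multiset.mem_bind.1 hK
        obtain ⟨L, hL, hLK⟩ := ih N hN hD K hK
        exact ⟨L, Multiset.mem_bind.2 ⟨f N, hf N hN, hL⟩, hLK⟩
    simp only [dsubst_bangSum, Expr.subst_idSub, bind_singleton_self]
    exact (hUT'.map₂ (.singleton (.bang h hUT hP)) .linear).add ((ih' hD).map (.bang h hUT))

theorem covers_subst (h : Standard A A') (hσ : ∀ n, SumRed (σ n) (σ' n))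
    (hσ' : ∀ n, Covers Standard (σ n) (σ' n)) : Covers Standard (A.subst σ) (A'.subst σ') := by
  have star {M M' : Term} (h : ReflTransGen WeakHead M M') (σ : ℕ → FormalSum .term) :
      Covers (ReflTransGen WeakHead) (M.subst σ) (M'.subst σ) :=
    .reflTransGen (f := Expr.subst σ) (fun h => h.subst σ) h
  induction h generalizing σ σ' with
  | var h => exact (star h σ).trans (hσ' _) expand
  | lam h _ ih =>
    refine (star h σ).trans ?_ expand
    rw [Expr.subst_lam, Expr.subst_lam]
    exact (ih (SumRed.liftSub hσ) (covers_liftSub hσ')).map (.lam .refl)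
  | app h _ _ ih ih' =>
    refine (star h σ).trans ?_ expand
    rw [Expr.subst_app, Expr.subst_app]
    exact (ih hσ hσ').map₂ (ih' hσ hσ') (.app .refl)
  | one => exact covers_refl _
  | linear _ _ ih ih' =>
    rw [Expr.subst_cons_linear, Expr.subst_cons_linear]
    exact (ih hσ hσ').map₂ (ih' hσ hσ') .linear
  | reusable f h hf _ _ ih ih' =>
    rw [subst_bangSum, subst_bangSum]
    refine (ih' hσ hσ').map (.bang (h.subst_congr hσ) fun K hK => ?_)
    obtain ⟨N, hN, hK⟩ := Multiset.mem_bind.1 hK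
    obtain ⟨L, hL, hLK⟩ := ih N hN hσ hσ' K hK
    exact ⟨L, Multiset.mem_bind.2 ⟨f N, hf N hN, hL⟩, hLK⟩

theorem covers_bagSubst {P P' : Bag} (h : Standard P P') {S S' : FormalSum s}
    (hS : Covers Standard S S') : Covers Standard (bagSubst P S) (bagSubst P' S') := by
  induction h using bagInduction generalizing S S' with
  | one => simpa using hS
  | @linear M M' P P' hM _ ih =>
    simp only [bagSubst_cons, Expr.resSubst_linear]
    refine ih (hS.bind fun hA => hA.covers_dsubst fun n => ?_)
    cases n
    exacts [.singleton (hM.rename _), covers_refl 0]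
  | @bang U T P P' h hUT _ ih =>
    simp only [bagSubst_bangSum]
    refine ih (hS.bind fun hA => hA.covers_subst (fun n => ?_) fun n => ?_)
    · cases n
      exacts [(h.map_rename _).add_right _, .refl _]
    · cases n
      exacts [(hUT.map (rename · _)).add (covers_refl _), covers_refl _]

theorem covers_giant {P P' : Bag} (h : Standard P P') (hA : Standard A A') :
    Covers Standard (giant P {A}) (giant P' {A'}) := by
  simp only [giant, Expr.zeroSubst_eq_subst]
  exact (h.covers_bagSubst (.singleton hA)).bind fun hB =>
    hB.covers_subst (fun n => .refl _) fun n => covers_refl _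

theorem trans_giantStep {T : FormalSum s} (h : Standard A A') (h' : GiantStep A' T) {B : Expr s}
    (hB : B ∈ T) : Standard A B := by
  induction h' with
  | beta M' P' =>
    obtain ⟨A₁, P, h, hA₁, hP⟩ := h.app_inv
    obtain ⟨M, h', hM⟩ := hA₁.lam_inv
    obtain ⟨R, hR, hRB⟩ := hP.covers_giant hM B hB
    have h'' : ReflTransGen WeakHead (A₁.app P) (M.lam.app P) :=
      ReflTransGen.lift (Expr.app · P) (fun _ _ => .app P) _ _ h'
    exact hRB.expand ((h.trans h'').tail (.beta hR))
  | lam _ ih =>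
    obtain ⟨C, hC, rfl⟩ := Multiset.mem_map.1 hB
    obtain ⟨A₁, h, hA₁⟩ := h.lam_inv
    exact .lam h (ih hA₁ hC)
  | appL P _ ih =>
    obtain ⟨C, hC, rfl⟩ := Multiset.mem_map.1 hB
    obtain ⟨A₁, P₁, h, hA₁, hP₁⟩ := h.app_inv
    exact .app h (ih hA₁ hC) hP₁
  | appR M _ ih =>
    obtain ⟨C, hC, rfl⟩ := Multiset.mem_map.1 hB
    obtain ⟨A₁, P₁, h, hA₁, hP₁⟩ := h.app_inv
    exact .app h hA₁ (ih hP₁ hC)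
  | linear P _ ih =>
    obtain ⟨C, hC, rfl⟩ := Multiset.mem_map.1 hB
    obtain ⟨M, P₁, rfl, hM, hP₁⟩ := h.linear_inv
    exact .linear (ih hM hC) hP₁
  | @reusable M T P hT ih =>
    obtain rfl := Multiset.mem_singleton.1 hB
    obtain ⟨U, V, Q, Q', rfl, rfl, hU, hV, hQ⟩ := h.reusable_inv
    rw [← bangSum_add]
    refine bang (hU.tail (.mk V hT)) (fun N hN => ?_) hQ
    rcases Multiset.mem_add.1 hN with hN | hN
    · obtain ⟨M₀, hM₀, h⟩ := hV M (Multiset.mem_cons_self _ _)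
      exact ⟨M₀, hM₀, ih h hN⟩
    · exact hV N (Multiset.mem_cons_of_mem hN)

theorem of_ndStep_star (h : ReflTransGen NDStep A A') : Standard A A' := by
  induction h with
  | refl => exact refl _
  | tail _ h ih =>
    obtain ⟨T, hT, hB⟩ := ndStep_iff.1 h
    exact ih.trans_giantStep hT hB

end Standard

/-! ### Outer normal forms -/

theorem isOnf_var (n : ℕ) : IsOnf (Expr.var n) := by
  rintro C R - ⟨M, P, rfl⟩ h
  cases C <;> simp [Ctx.fill] at h

theorem isOnf_one : IsOnf Expr.one := by
  rintro C R - - h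
  cases C; simp [Ctx.fill] at h

theorem isOnf_lam {M : Term} : IsOnf (Expr.lam M) ↔ IsOnf M := by
  constructor
  · rintro h C R hC hR rfl
    exact h (.lam C) R hC hR rfl
  · rintro h C R hC ⟨L, P, rfl⟩ e
    cases C with
    | lam C => exact h C _ hC ⟨L, P, rfl⟩ (by simpa [Ctx.fill] using e)
    | _ => simp [Ctx.fill] at e

theorem isOnf_app {M : Term} {P : Bag} :
    IsOnf (Expr.app M P) ↔ (∀ L, M ≠ Expr.lam L) ∧ IsOnf M ∧ IsOnf P := by
  constructor
  · intro h
    refine ⟨?_, ?_, ?_⟩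
    · rintro L rfl
      exact h .hole _ trivial ⟨L, P, rfl⟩ rfl
    · rintro C R hC hR rfl
      exact h (.appL C P) R hC hR rfl
    · rintro C R hC hR rfl
      exact h (.appR M C) R hC hR rfl
  · rintro ⟨hM, hM', hP⟩ C R hC ⟨L, Q, rfl⟩ e
    cases C with
    | hole => exact hM L (Expr.app_inj.1 e).1
    | lam C => simp [Ctx.fill] at e
    | appL C P' => exact hM' C _ hC ⟨L, Q, rfl⟩ (Expr.app_inj.1 e).1
    | appR M' C => exact hP C _ hC ⟨L, Q, rfl⟩ (Expr.app_inj.1 e).2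

theorem IsOnf.tail {r : Mode} {M : Term} {P : Bag} (h : IsOnf (Expr.cons r M P)) :
    IsOnf P := by
  rintro C R hC hR rfl
  cases C with
  | bag r' C Q =>
    cases r'
    · exact h (.bag .linear C (Expr.cons r M Q)) R hC hR (Expr.cons_swap _ _ _ _ _)
    · exact hC.elim

theorem isOnf_cons_linear {M : Term} {P : Bag} :
    IsOnf (Expr.cons .linear M P) ↔ IsOnf M ∧ IsOnf P := by
  constructor
  · intro h
    refine ⟨?_, h.tail⟩
    rintro C R hC hR rfl
    exact h (.bag .linear C P) R hC hR rfl
  · rintro ⟨hM, hP⟩ C R hC hR e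
    cases C with
    | bag r C Q =>
      cases r
      · rcases Expr.cons_eq_cons.1 e with ⟨-, rfl, -⟩ | ⟨Q', rfl, -⟩
        · exact hM C R hC hR rfl
        · exact hP (.bag .linear C Q') R hC hR rfl
      · exact hC

theorem isOnf_cons_reusable {M : Term} {P : Bag} : IsOnf (Expr.cons .reusable M P) ↔ IsOnf P := by
  refine ⟨IsOnf.tail, fun h C R hC hR e => ?_⟩
  cases C with
  | bag r C Q =>
    cases r
    · rcases Expr.cons_eq_cons.1 e with ⟨e, -⟩ | ⟨Q', rfl, -⟩
      · cases e
      · exact h (.bag .linear C Q') R hC hR rfl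
    · exact hC

theorem isOnf_bangSum {S : FormalSum .term} {P : Bag} : IsOnf (bangSum S P) ↔ IsOnf P := by
  induction S using Multiset.induction_on with
  | empty => simp
  | cons a S ih => rw [bangSum_cons_left, isOnf_cons_reusable, ih]

theorem GiantStep.ne_lam {M : Term} {T : FormalSum .term} (h : GiantStep M T)
    (hM : ∀ L, M ≠ Expr.lam L) (hM' : IsOnf M) {B : Term} (hB : B ∈ T) (L : Term) :
    B ≠ Expr.lam L := by
  rintro rfl
  cases h with
  | beta M P => exact absurd rfl ((isOnf_app.1 hM').1 M)
  | lam _ => exact absurd rfl (hM _)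
  | appL P _ => simp at hB
  | appR M _ => simp at hB

theorem IsOnf.giantStep {s : Kind} {A B : Expr s} {T : FormalSum s} (hA : IsOnf A)
    (h : GiantStep A T) (hB : B ∈ T) : IsOnf B := by
  induction h with
  | beta M P => exact absurd rfl ((isOnf_app.1 hA).1 M)
  | lam _ ih =>
    obtain ⟨B, hB', rfl⟩ := Multiset.mem_map.1 hB
    exact isOnf_lam.2 (ih (isOnf_lam.1 hA) hB')
  | appL P h ih =>
    obtain ⟨hM, hM', hP⟩ := isOnf_app.1 hA
    obtain ⟨B, hB', rfl⟩ := Multiset.mem_map.1 hB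
    exact isOnf_app.2 ⟨h.ne_lam hM hM' hB', ih hM' hB', hP⟩
  | appR M _ ih =>
    obtain ⟨hM, hM', hP⟩ := isOnf_app.1 hA
    obtain ⟨B, hB', rfl⟩ := Multiset.mem_map.1 hB
    exact isOnf_app.2 ⟨hM, hM', ih hP hB'⟩
  | linear P _ ih =>
    obtain ⟨hM, hP⟩ := isOnf_cons_linear.1 hA
    obtain ⟨B, hB', rfl⟩ := Multiset.mem_map.1 hB
    exact isOnf_cons_linear.2 ⟨ih hM hB', hP⟩
  | reusable P _ _ =>
    obtain rfl := Multiset.mem_singleton.1 hB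
    exact isOnf_bangSum.2 (isOnf_cons_reusable.1 hA)

/-! ### Leftmost redexes -/

theorem PreExpr.isLam_iff (m : PreExpr .term) : m.IsLam ↔ ∃ L, m.toExpr = Expr.lam L := by
  constructor
  · intro h
    cases m with
    | lam m => exact ⟨m.toExpr, rfl⟩
    | _ => exact h.elim
  · rintro ⟨L, h⟩
    induction L using Quotient.inductionOn with
    | h l => exact (PreExpr.Equiv.isLam (Quotient.exact h)).2 trivial

namespace Expr

variable (M : Term) (P : Bag)

@[simp] theorem leftmost_var (n : ℕ) : (var n).leftmost = ∅ := rfl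

@[simp] theorem leftmost_one : one.leftmost = ∅ := rfl

@[simp] theorem leftmost_lam :
    (lam M).leftmost = (fun o : Occ .term => (Ctx.lam o.1, o.2)) '' M.leftmost := by
  induction M using Quotient.inductionOn; rfl

theorem leftmost_redex : (app (lam M) P).leftmost = {(Ctx.hole, app (lam M) P)} := by
  induction M using Quotient.inductionOn
  induction P using Quotient.inductionOn
  exact if_pos trivial

variable {M} in
theorem leftmost_appL (h : ∀ L, M ≠ lam L) (h' : M.leftmost ≠ ∅) :
    (app M P).leftmost = (fun o : Occ .term => (Ctx.appL o.1 P, o.2)) '' M.leftmost := by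
  induction M using Quotient.inductionOn with
  | h m =>
    induction P using Quotient.inductionOn
    refine (if_neg ?_).trans (if_pos h')
    rw [PreExpr.isLam_iff]
    exact fun ⟨L, e⟩ => h L e

variable {M} in
theorem leftmost_appR (h : ∀ L, M ≠ lam L) (h' : M.leftmost = ∅) :
    (app M P).leftmost = (fun o : Occ .bag => (Ctx.appR M o.1, o.2)) '' P.leftmost := by
  induction M using Quotient.inductionOn with
  | h m =>
    induction P using Quotient.inductionOn
    refine (if_neg ?_).trans (if_neg (not_not.2 h'))
    rw [PreExpr.isLam_iff]
    exact fun ⟨L, e⟩ => h L e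

@[simp] theorem leftmost_cons_linear : (cons .linear M P).leftmost =
    (fun o : Occ .term => (Ctx.bag .linear o.1 P, o.2)) '' M.leftmost ∪
      (fun o : Occ .bag => (o.1.consTail .linear M, o.2)) '' P.leftmost := by
  induction M using Quotient.inductionOn; induction P using Quotient.inductionOn; rfl

@[simp] theorem leftmost_cons_reusable : (cons .reusable M P).leftmost =
    (fun o : Occ .bag => (o.1.consTail .reusable M, o.2)) '' P.leftmost := by
  induction M using Quotient.inductionOn; induction P using Quotient.inductionOn; rfl

end Expr

theorem IsOnf.leftmost_eq_empty {s : Kind} {A : Expr s} (h : IsOnf A) : A.leftmost = ∅ := by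
  induction A using Expr.induction with
  | var n => simp
  | lam M ih => simp [ih (isOnf_lam.1 h)]
  | app M P ih ih' =>
    obtain ⟨hM, hM', hP⟩ := isOnf_app.1 h
    simp [Expr.leftmost_appR P hM (ih hM'), ih' hP]
  | one => simp
  | cons r M P ih ih' =>
    cases r
    · obtain ⟨hM, hP⟩ := isOnf_cons_linear.1 h
      simp [ih hM, ih' hP]
    · simp [ih' (isOnf_cons_reusable.1 h)]

theorem IsOnf.nonLmStep_star {s : Kind} {A B : Expr s} (hA : IsOnf A)
    (h : ReflTransGen NDStep A B) : ReflTransGen NonLmStep A B := by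
  suffices ReflTransGen NonLmStep A B ∧ IsOnf B from this.1
  induction h with
  | refl => exact ⟨.refl, hA⟩
  | tail _ h ih =>
    obtain ⟨ih, hB⟩ := ih
    obtain ⟨T, hT, hC⟩ := ndStep_iff.1 h
    obtain ⟨o, ho⟩ := h
    exact ⟨ih.tail ⟨o, ho, by simp [hB.leftmost_eq_empty]⟩, hB.giantStep hT hC⟩

/-! ### Leftmost steps -/

theorem LmStep.ndStep {s : Kind} {A B : Expr s} (h : LmStep A B) : NDStep A B :=
  let ⟨o, h, _⟩ := h
  ⟨o, h⟩

theorem lmStep_iff {s : Kind} {A B : Expr s} : LmStep A B ↔ ∃ C R S, C.IsLinear ∧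
    (C, R) ∈ A.leftmost ∧ A = C.fill R ∧ RootGiant R S ∧ B ∈ C.fillSum S := by
  constructor
  · rintro ⟨⟨C, R⟩, ⟨T, U, ⟨hA, S, hS, rfl⟩, hB⟩, hC, h⟩
    exact ⟨C, R, S, hC, h, hA, hS, by simp [hB]⟩
  · rintro ⟨C, R, S, hC, h, hA, hS, hB⟩
    obtain ⟨U, hU⟩ := Multiset.exists_cons_of_mem hB
    exact ⟨(C, R), ⟨_, U, ⟨hA, S, hS, rfl⟩, by rw [hU, Multiset.singleton_add]⟩, hC, h⟩

theorem lmStep_redex_iff {M K : Term} {P : Bag} :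
    LmStep (Expr.app (Expr.lam M) P) K ↔ K ∈ giant P {M} := by
  rw [lmStep_iff]
  constructor
  · rintro ⟨C, R, S, -, h, -, hS, hK⟩
    rw [Expr.leftmost_redex, Set.mem_singleton_iff, Prod.mk.injEq] at h
    obtain ⟨rfl, rfl⟩ := h
    obtain ⟨M', P', e, rfl⟩ := rootGiant_iff.1 hS
    simp only [Expr.app_inj, Expr.lam_inj] at e
    obtain ⟨rfl, rfl⟩ := e
    exact hK
  · intro h
    exact ⟨.hole, _, _, trivial, by rw [Expr.leftmost_redex]; rfl, rfl,
      rootGiant_iff.2 ⟨M, P, rfl, rfl⟩, h⟩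

namespace LmStep

theorem lam {M M' : Term} (h : LmStep M M') : LmStep (Expr.lam M) (Expr.lam M') := by
  obtain ⟨C, R, S, hC, h, rfl, hS, hM⟩ := lmStep_iff.1 h
  exact lmStep_iff.2 ⟨.lam C, R, S, hC, by rw [Expr.leftmost_lam]; exact ⟨_, h, rfl⟩, rfl, hS,
    Multiset.mem_map_of_mem _ hM⟩

theorem appL {M M' : Term} (h : LmStep M M') (hM : ∀ L, M ≠ Expr.lam L) (P : Bag) :
    LmStep (Expr.app M P) (Expr.app M' P) := by
  obtain ⟨C, R, S, hC, h, rfl, hS, hM'⟩ := lmStep_iff.1 h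
  refine lmStep_iff.2 ⟨.appL C P, R, S, hC, ?_, rfl, hS, Multiset.mem_map_of_mem _ hM'⟩
  rw [Expr.leftmost_appL P hM (Set.nonempty_iff_ne_empty.1 ⟨_, h⟩)]
  exact ⟨_, h, rfl⟩

theorem of_appL {M K : Term} {P : Bag} (h : LmStep (Expr.app M P) K)
    (hM : ∀ L, M ≠ Expr.lam L) (hM' : M.leftmost ≠ ∅) :
    ∃ M', LmStep M M' ∧ K = Expr.app M' P := by
  obtain ⟨C, R, S, hC, h, e, hS, hK⟩ := lmStep_iff.1 h
  rw [Expr.leftmost_appL P hM hM'] at h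
  obtain ⟨⟨C, R⟩, h', e'⟩ := h
  obtain ⟨rfl, rfl⟩ := Prod.mk.inj e'
  obtain ⟨M', hM', rfl⟩ := Multiset.mem_map.1 hK
  exact ⟨M', lmStep_iff.2 ⟨C, R, S, hC, h', (Expr.app_inj.1 e).1, hS, hM'⟩, rfl⟩

theorem appR {M : Term} {P P' : Bag} (h : LmStep P P') (hM : ∀ L, M ≠ Expr.lam L)
    (hM' : M.leftmost = ∅) : LmStep (Expr.app M P) (Expr.app M P') := by
  obtain ⟨C, R, S, hC, h, rfl, hS, hP⟩ := lmStep_iff.1 h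
  refine lmStep_iff.2 ⟨.appR M C, R, S, hC, ?_, rfl, hS, Multiset.mem_map_of_mem _ hP⟩
  rw [Expr.leftmost_appR _ hM hM']
  exact ⟨_, h, rfl⟩

theorem linear {M M' : Term} (h : LmStep M M') (P : Bag) :
    LmStep (Expr.cons .linear M P) (Expr.cons .linear M' P) := by
  obtain ⟨C, R, S, hC, h, rfl, hS, hM⟩ := lmStep_iff.1 h
  refine lmStep_iff.2 ⟨.bag .linear C P, R, S, hC, ?_, rfl, hS, Multiset.mem_map_of_mem _ hM⟩
  rw [Expr.leftmost_cons_linear]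
  exact .inl ⟨_, h, rfl⟩

theorem cons {P P' : Bag} (h : LmStep P P') (r : Mode) (M : Term) :
    LmStep (Expr.cons r M P) (Expr.cons r M P') := by
  obtain ⟨C, R, S, hC, h, rfl, hS, hP⟩ := lmStep_iff.1 h
  refine lmStep_iff.2 ⟨C.consTail r M, R, S, ?_, ?_, ?_, hS, ?_⟩
  · cases C with
    | bag r' C Q => cases r' <;> exact hC
  · cases r
    · rw [Expr.leftmost_cons_linear]; exact .inr ⟨_, h, rfl⟩
    · rw [Expr.leftmost_cons_reusable]; exact ⟨_, h, rfl⟩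
  · cases C; exact Expr.cons_swap _ _ _ _ _
  · cases C with
    | bag r' C Q =>
      cases r'
      · obtain ⟨K, hK, rfl⟩ := Multiset.mem_map.1 hP
        exact Multiset.mem_map.2 ⟨K, hK, Expr.cons_swap _ _ _ _ _⟩
      · exact hC.elim

end LmStep

/-! ### Iterated application -/

@[simp] theorem apps_nil (M : Term) : apps M [] = M := rfl

theorem apps_concat (M : Term) (P : Bag) (Ps : List Bag) :
    apps M (Ps ++ [P]) = Expr.app (apps M Ps) P := by
  simp [apps]

theorem apps_app_ne_lam (M : Term) (P : Bag) (Ps : List Bag) (L : Term) :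
    apps (Expr.app M P) Ps ≠ Expr.lam L := by
  induction Ps using List.reverseRecOn with
  | nil => simp
  | append_singleton Ps P _ => simp [apps_concat]

theorem IsOnf.of_apps {M : Term} {Ps : List Bag} (h : IsOnf (apps M Ps)) : IsOnf M := by
  induction Ps generalizing M with
  | nil => exact h
  | cons P Ps ih => exact (isOnf_app.1 (ih h)).2.1

theorem IsOnf.apps {M : Term} (hM : IsOnf M) (hM' : ∀ L, M ≠ Expr.lam L) {Ps : List Bag}
    (h : ∀ P ∈ Ps, IsOnf P) : IsOnf (apps M Ps) := by
  induction Ps generalizing M with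
  | nil => exact hM
  | cons P Ps ih =>
    rw [List.forall_mem_cons] at h
    exact ih (isOnf_app.2 ⟨hM', hM, h.1⟩) (by simp) h.2

theorem LmStep.apps {M M' : Term} (h : LmStep M M') (hM : ∀ L, M ≠ Expr.lam L)
    (Ps : List Bag) : LmStep (apps M Ps) (ResourceCalculus.apps M' Ps) := by
  induction Ps generalizing M M' with
  | nil => exact h
  | cons P _ ih => exact ih (h.appL hM P) (by simp)

theorem leftmost_apps_redex_ne_empty (M : Term) (P : Bag) (Ps : List Bag) :
    (apps (Expr.app (Expr.lam M) P) Ps).leftmost ≠ ∅ := by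
  induction Ps using List.reverseRecOn with
  | nil => simp [Expr.leftmost_redex]
  | append_singleton Ps Q ih =>
    rw [apps_concat, Expr.leftmost_appL Q (apps_app_ne_lam _ _ _) ih]
    simpa using ih

theorem lmStep_apps_redex_iff {M K : Term} {P : Bag} {Ps : List Bag} :
    LmStep (apps (Expr.app (Expr.lam M) P) Ps) K ↔ ∃ R ∈ giant P {M}, K = apps R Ps := by
  constructor
  · intro h
    induction Ps using List.reverseRecOn generalizing K with
    | nil => exact ⟨K, lmStep_redex_iff.1 h, rfl⟩
    | append_singleton Ps Q ih =>
      rw [apps_concat] at h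
      obtain ⟨K, h', rfl⟩ :=
        h.of_appL (apps_app_ne_lam _ _ _) (leftmost_apps_redex_ne_empty _ _ _)
      obtain ⟨R, hR, rfl⟩ := ih h'
      exact ⟨R, hR, (apps_concat _ _ _).symm⟩
  · rintro ⟨R, hR, rfl⟩
    exact (lmStep_redex_iff.2 hR).apps (by simp) Ps

theorem WeakHead.exists_apps {M M' : Term} (h : WeakHead M M') : ∃ A P Ps, ∃ R ∈ giant P {A},
    M = apps (Expr.app (Expr.lam A) P) Ps ∧ M' = apps R Ps := by
  induction h with
  | @beta M R P hR => exact ⟨M, P, [], R, hR, rfl, rfl⟩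
  | app Q _ ih =>
    obtain ⟨A, P, Ps, R, hR, rfl, rfl⟩ := ih
    exact ⟨A, P, Ps ++ [Q], R, hR, (apps_concat _ _ _).symm, (apps_concat _ _ _).symm⟩

/-! ### Soundness of the machine -/

@[simp] theorem giant_one {s : Kind} (A : Expr s) : giant Expr.one {A} = A.zeroSubst := by
  simp [giant]

theorem mem_giant_cons {s : Kind} {A B : Expr s} {r : Mode} {N : Term} {P : Bag} :
    B ∈ giant (Expr.cons r N P) {A} ↔ ∃ A' ∈ A.resSubst 0 r N.shift, B ∈ giant P {A'} := by
  rw [giant, bagSubst_cons, Multiset.singleton_bind]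
  exact mem_giant

theorem lmStep_star_apps {M : Term} (hM : ∀ L, M ≠ Expr.lam L) (hM' : IsOnf M)
    {Qs : List (Bag × Bag)} (h : ∀ q ∈ Qs, ReflTransGen LmStep q.1 q.2 ∧ IsOnf q.2) :
    ReflTransGen LmStep (apps M (Qs.map Prod.fst)) (apps M (Qs.map Prod.snd)) := by
  induction Qs generalizing M with
  | nil => exact .refl
  | cons q Qs ih =>
    rw [List.forall_mem_cons] at h
    have reduce_first : ReflTransGen LmStep (apps (Expr.app M q.1) (Qs.map Prod.fst))
        (apps (Expr.app M q.2) (Qs.map Prod.fst)) :=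
      ReflTransGen.lift (fun P => apps (Expr.app M P) (Qs.map Prod.fst))
        (fun _ _ hP => (hP.appR hM hM'.leftmost_eq_empty).apps (by simp) _) _ _ h.1.1
    exact reduce_first.trans (ih (by simp) (isOnf_app.2 ⟨hM, hM', h.1.2⟩) h.2)

/-- The machine substitutes one resource at a time, whereas a leftmost step substitutes the whole
bag: the first step from `(λx.M')P` is prolonged by the substitution of `N` to one from
`(λx.M)([N^(!)]·P)`. -/
theorem lmStep_star_apps_redex_cons {M M' N N' : Term} {r : Mode} {P : Bag} {Ps : List Bag}
    (hM : M' ∈ M.resSubst 0 r N.shift)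
    (h : ReflTransGen LmStep (apps (Expr.app (Expr.lam M') P) Ps) N') (hN : IsOnf N') :
    ReflTransGen LmStep (apps (Expr.app (Expr.lam M) (Expr.cons r N P)) Ps) N' := by
  rcases h.cases_head with rfl | ⟨K, hK, h⟩
  · exact absurd rfl ((isOnf_app.1 hN.of_apps).1 M')
  · obtain ⟨R, hR, rfl⟩ := lmStep_apps_redex_iff.1 hK
    exact .head (lmStep_apps_redex_iff.2 ⟨R, mem_giant_cons.2 ⟨M', hM, hR⟩, rfl⟩) h

theorem NDMachine.sound {M N : Term} (h : NDMachine M N) :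
    ReflTransGen LmStep M N ∧ IsOnf N := by
  induction h using NDMachine.rec
    (motive_2 := fun P Q _ => ReflTransGen LmStep P Q ∧ IsOnf Q) with
  | lam M M' _ ih =>
    exact ⟨ReflTransGen.lift Expr.lam (fun _ _ h => h.lam) _ _ ih.1, isOnf_lam.2 ih.2⟩
  | endRule M hM => exact ⟨.refl, hM⟩
  | head x Qs _ ih =>
    refine ⟨lmStep_star_apps (by simp) (isOnf_var x) ih, (isOnf_var x).apps (by simp) ?_⟩
    exact List.forall_mem_map.2 fun q hq => (ih q hq).2
  | zero M M₀ M' Ps hM _ ih =>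
    exact ⟨.head (lmStep_apps_redex_iff.2 ⟨M₀, by simp [hM], rfl⟩) ih.1, ih.2⟩
  | beta M N M' M'' P Ps U hM _ ih =>
    have hM' : M' ∈ M.resSubst 0 .linear N.shift := by simp [Expr.resSubst, hM]
    exact ⟨lmStep_star_apps_redex_cons hM' ih.1 ih.2, ih.2⟩
  | bangBeta M N M' M'' P Ps U hM _ ih =>
    have hM' : M' ∈ M.resSubst 0 .reusable N.shift := by simp [Expr.resSubst, hM]
    exact ⟨lmStep_star_apps_redex_cons hM' ih.1 ih.2, ih.2⟩
  | one => exact ⟨.refl, isOnf_one⟩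
  | lin M N P P' _ _ ih ih' =>
    have hM : ReflTransGen LmStep (Expr.cons .linear M P) (Expr.cons .linear N P) :=
      ReflTransGen.lift (Expr.cons .linear · P) (fun _ _ h => h.linear P) _ _ ih.1
    have hP : ReflTransGen LmStep (Expr.cons .linear N P) (Expr.cons .linear N P') :=
      ReflTransGen.lift _ (fun _ _ h => h.cons .linear N) _ _ ih'.1
    exact ⟨hM.trans hP, isOnf_cons_linear.2 ⟨ih.2, ih'.2⟩⟩
  | bang M P P' _ ih =>
    exact ⟨ReflTransGen.lift _ (fun _ _ h => h.cons .reusable M) _ _ ih.1,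
      isOnf_cons_reusable.2 ih.2⟩

/-! ### Completeness of the machine -/

theorem card_bind_le_one {α β : Type*} {S : Multiset α} {f : α → Multiset β}
    (hS : S.card ≤ 1) (hf : ∀ a, (f a).card ≤ 1) : (S.bind f).card ≤ 1 := by
  rcases Nat.le_one_iff_eq_zero_or_eq_one.1 hS with h | h
  · simp [Multiset.card_eq_zero.1 h]
  · obtain ⟨a, rfl⟩ := Multiset.card_eq_one.1 h
    simpa using hf a

namespace Expr

variable {s : Kind}

theorem card_subst_le_one (A : Expr s) {σ : ℕ → FormalSum .term} (h : ∀ n, (σ n).card ≤ 1) :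
    (A.subst σ).card ≤ 1 := by
  induction A using Expr.induction generalizing σ with
  | var n => simpa using h n
  | lam M ih =>
    rw [subst_lam, Multiset.card_map]
    refine ih fun n => ?_
    cases n with
    | zero => simp [liftSub]
    | succ n => simpa [liftSub] using h n
  | app M P ih ih' =>
    rw [subst_app]
    exact card_bind_le_one (ih h) fun M => by simpa using ih' h
  | one => simp
  | cons r M P ih ih' =>
    cases r
    · rw [subst_cons_linear]
      exact card_bind_le_one (ih h) fun M => by simpa using ih' h
    · rw [subst_cons_reusable, Multiset.card_map]
      exact ih' h

theorem zeroSubst_eq_singleton {A B : Expr s} (h : B ∈ A.zeroSubst) : A.zeroSubst = {B} := by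
  have card_le : A.zeroSubst.card ≤ 1 := by
    rw [zeroSubst_eq_subst]
    refine card_subst_le_one A fun n => ?_
    cases n <;> simp [zeroSub]
  have card_pos : 0 < A.zeroSubst.card := Multiset.card_pos_iff_exists_mem.2 ⟨B, h⟩
  obtain ⟨C, hC⟩ := Multiset.card_eq_one.1 (card_le.antisymm card_pos)
  rw [hC, Multiset.mem_singleton] at h
  rw [hC, h]

end Expr

theorem NDMachine.apps_redex {M R N : Term} {P : Bag} {Ps : List Bag} (hR : R ∈ giant P {M})
    (h : NDMachine (apps R Ps) N) : NDMachine (apps (Expr.app (Expr.lam M) P) Ps) N := by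
  induction P using Expr.bagInduction generalizing M R with
  | one => exact .zero M R N Ps (Expr.zeroSubst_eq_singleton (by simpa using hR)) h
  | cons r L P ih =>
    obtain ⟨M', hM', hR'⟩ := mem_giant_cons.1 hR
    obtain ⟨U, hU⟩ := Multiset.exists_cons_of_mem hM'
    rw [← Multiset.singleton_add] at hU
    cases r
    · exact .beta M L M' N P Ps U hU (ih hR' h)
    · exact .bangBeta M L M' N P Ps U hU (ih hR' h)

theorem NDMachine.expand {M M' N : Term} (h : ReflTransGen WeakHead M M')
    (h' : NDMachine M' N) : NDMachine M N := by
  induction h with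
  | refl => exact h'
  | tail _ h ih =>
    obtain ⟨A, P, Ps, R, hR, rfl, rfl⟩ := h.exists_apps
    exact ih (h'.apps_redex hR)

theorem BMachine.bangSum {P P' : Bag} (h : BMachine P P') (U : FormalSum .term) :
    BMachine (bangSum U P) (ResourceCalculus.bangSum U P') := by
  induction U using Multiset.induction_on with
  | empty => simpa
  | cons a U ih => simpa using BMachine.bang a _ _ ih

theorem ndStep_star_map {s t : Kind} {f : Expr s → Expr t}
    (hf : ∀ A T, GiantStep A T → GiantStep (f A) (T.map f)) {A B : Expr s}
    (h : ReflTransGen NDStep A B) : ReflTransGen NDStep (f A) (f B) :=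
  ReflTransGen.lift f (fun A _ h =>
    let ⟨T, hT, hB⟩ := ndStep_iff.1 h
    ndStep_iff.2 ⟨_, hf A T hT, Multiset.mem_map_of_mem f hB⟩) _ _ h

theorem SumRed.ndStep_star_bangSum {U T : FormalSum .term} (h : SumRed U T) (P : Bag) :
    ReflTransGen NDStep (bangSum U P) (bangSum T P) :=
  ReflTransGen.lift (bangSum · P)
    (fun _ _ h => ndStep_iff.2 ⟨_, h.bangSum P, Multiset.mem_singleton_self _⟩) _ _ h

/-- `M` weak head reduces to a term `x P₁ … P_m`, on whose arguments the `B`-machine has outcomes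
`P'_i` such that `x P'₁ … P'_m →nd* N`. As in `NDMachine.head`, `Qs` lists the pairs
`(P_i, P'_i)`. -/
def HeadExecutes (M N : Term) : Prop :=
  ∃ (x : ℕ) (Qs : List (Bag × Bag)),
    ReflTransGen WeakHead M (apps (Expr.var x) (Qs.map Prod.fst)) ∧
    (∀ q ∈ Qs, BMachine q.1 q.2) ∧ ReflTransGen NDStep (apps (Expr.var x) (Qs.map Prod.snd)) N

namespace HeadExecutes

variable {M A N : Term} {P P' Q : Bag}

theorem var {x : ℕ} (h : ReflTransGen WeakHead M (Expr.var x)) : HeadExecutes M (Expr.var x) :=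
  ⟨x, [], h, by simp, .refl⟩

theorem app (hM : ReflTransGen WeakHead M (Expr.app A P)) (hA : HeadExecutes A N)
    (hP : BMachine P P') (hQ : ReflTransGen NDStep P' Q) : HeadExecutes M (Expr.app N Q) := by
  obtain ⟨x, Qs, hx, hQs, hN⟩ := hA
  refine ⟨x, Qs ++ [(P, P')], ?_, List.forall_mem_append.2 ⟨hQs, by simpa using hP⟩, ?_⟩
  · simpa only [List.map_append, List.map_cons, List.map_nil, apps_concat] using
      hM.trans (ReflTransGen.lift (Expr.app · P) (fun _ _ => .app P) _ _ hx)
  · simpa only [List.map_append, List.map_cons, List.map_nil, apps_concat] using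
      (ndStep_star_map (fun _ _ => .appL P') hN).trans (ndStep_star_map (fun _ _ => .appR N) hQ)

theorem exists_ndMachine (h : HeadExecutes M N) :
    ∃ N', NDMachine M N' ∧ ReflTransGen NDStep N' N := by
  obtain ⟨x, Qs, hx, hQs, hN⟩ := h
  exact ⟨_, .expand hx (.head x Qs hQs), hN⟩

end HeadExecutes

/-- The machine started on `A` has an outcome that reduces to `B`. For the induction, a term `B`
that may stand in head position, i.e. is not an abstraction, is moreover reached through a head
variable. -/
def Executes : {s : Kind} → Expr s → Expr s → Prop
  | .term, M, N => (∃ N', NDMachine M N' ∧ ReflTransGen NDStep N' N) ∧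
      ((∀ L, N ≠ Expr.lam L) → HeadExecutes M N)
  | .bag, P, Q => ∃ Q', BMachine P Q' ∧ ReflTransGen NDStep Q' Q

theorem HeadExecutes.executes {M N : Term} (h : HeadExecutes M N) : Executes M N :=
  ⟨h.exists_ndMachine, fun _ => h⟩

theorem Standard.executes {s : Kind} {A B : Expr s} (h : Standard A B) (hB : IsOnf B) :
    Executes A B := by
  induction h with
  | var h => exact (HeadExecutes.var h).executes
  | lam h _ ih =>
    obtain ⟨⟨N, hN, h'⟩, -⟩ := ih (isOnf_lam.1 hB)
    exact ⟨⟨_, .expand h (.lam _ _ hN), ndStep_star_map (fun _ _ => .lam) h'⟩,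
      fun not_lam => absurd rfl (not_lam _)⟩
  | app h _ _ ih ih' =>
    obtain ⟨not_lam, hA, hP⟩ := isOnf_app.1 hB
    obtain ⟨P', hP', hP''⟩ := ih' hP
    exact (((ih hA).2 not_lam).app h hP' hP'').executes
  | one => exact ⟨_, .one, .refl⟩
  | @linear M M' P P' _ _ ih ih' =>
    obtain ⟨hM, hP⟩ := isOnf_cons_linear.1 hB
    obtain ⟨⟨N, hN, hN'⟩, -⟩ := ih hM
    obtain ⟨Q, hQ, hQ'⟩ := ih' hP
    exact ⟨_, .lin _ _ _ _ hN hQ, (ndStep_star_map (fun _ _ => .linear Q) hN').trans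
      (ndStep_star_map (fun _ _ h => h.cons .linear M') hQ')⟩
  | @reusable U T P P' _ hUT _ _ _ _ ih =>
    obtain ⟨Q, hQ, hQ'⟩ := ih (isOnf_bangSum.1 hB)
    exact ⟨_, hQ.bangSum U, (hUT.ndStep_star_bangSum Q).trans
      (ndStep_star_map (fun _ _ h => h.bangSum_right T) hQ')⟩

theorem NDMachine.complete {M N : Term} (h : ReflTransGen NDStep M N) (hN : IsOnf N) :
    ∃ N', NDMachine M N' ∧ ReflTransGen NDStep N' N :=
  ((Standard.of_ndStep_star h).executes hN).1

end ResourceCalculus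

theorem mainTheorem2 :
    (∀ M N : ResourceCalculus.Term, ResourceCalculus.NDMachine M N →
      Relation.ReflTransGen ResourceCalculus.LmStep M N ∧ ResourceCalculus.IsOnf N) ∧
    (∀ M : ResourceCalculus.Term, ResourceCalculus.MayOuterNormalizable M →
      ∀ N : ResourceCalculus.Term, ResourceCalculus.IsMonf N M →
        ∃ N' : ResourceCalculus.Term, ResourceCalculus.NDMachine M N' ∧
          ResourceCalculus.IsMonf N' M ∧
          Relation.ReflTransGen ResourceCalculus.NonLmStep N' N) := by
  refine ⟨fun M N h => h.sound, fun M _ N ⟨h, hN⟩ => ?_⟩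
  obtain ⟨N', hN', h'⟩ := ResourceCalculus.NDMachine.complete h hN
  obtain ⟨lm_star, onf⟩ := hN'.sound
  exact ⟨N', hN', ⟨Relation.ReflTransGen.mono (fun _ _ h => h.ndStep) _ _ lm_star, onf⟩,
    onf.nonLmStep_star h'⟩
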